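/- Let $d\ge 1$, $\lambda,\alpha_1\in\mathbb R$ with $\alpha_1>2|\lambda|$, and write $\|\cdot\|$ for the norm of $L^2=L^2(\mathbb R^d;\mathbb C)$. Let $\mathcal X_1=H^1(\mathbb R^d;\mathbb C)\cap L^2_1$, where $L^2_1=\{z\in L^2:(1+|x|^2)^{1/2}z\in L^2\}$, with the norm $\|u\|_{\mathcal X_1}=\big(\|u\|^2+\|\nabla u\|^2+\|(1+|x|^2)^{1/2}u\|^2\big)^{1/2}$. For $\delta>0$ let $f_\delta(r)=\log\frac{\delta+r}{1+\delta r}$, $r\ge 0$. For $T>0$, $u_0\in\mathcal X_1$ and $g\in W^{1,2}([0,T];\mathbb R)$ with $g(0)=0$, write $y=L^\delta_{u_0}(g)$ if $y\in C([0,T];\mathcal X_1)$ is the mild solution of the skeleton equation, i.e., for all $t\in[0,T]$, $$y(t)=S_g(t,0)u_0+\int_0^tS_g(t,s)\,\mathbf i\lambda f_\delta(|y(s)|^2)y(s)\,ds-\int_0^t\alpha_1S_g(t,s)y(s)\,ds\quad\text{in }L^2,\qquad S_g(t,s)=e^{\mathbf i(g(t)-g(s))\Delta}.$$ For $y\in C([0,T];\mathcal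 X_1)$ define the rate function $$I^{\delta,T}_{u_0}(y)=\tfrac12\inf\Big\{\int_0^T|\dot g(t)|^2dt:\ g\in W^{1,2}([0,T];\mathbb R),\ g(0)=0,\ L^\delta_{u_0}(g)=y\Big\}\in[0,\infty],$$ where, here and below, $\inf\emptyset=+\infty$. Let $D\subset\mathcal X_1$ be a bounded open set with $0\in D$ (for instance a bounded domain containing $0$). Let $\overline D$ and $\partial D$ be its closure and boundary in $\mathcal X_1$, and for $\rho>0$ let $D_{-\rho}=D\setminus\{v\in\mathcal X_1:\operatorname{dist}_{\mathcal X_1}(v,\partial D)<\rho\}$ (with $D_{-\rho}=D$ if $\partial D=\emptyset$). Define, with values in $[0,\infty]$ and complements in $\mathcal X_1$, $$\overline{M^\delta}=\inf\{I^{\delta,T}_0(y): T>0,\ y\in C([0,T];\mathcal X_1),\ y(T)\in(\overline D)^c\},$$ $$M^\delta_\rho=\inf\{I^{\delta,T}_{u_0}(y): \|u_0\|_{\mathcal X_1}\le\rho,\ T>0,\ y\in C([0,T];\mathcal X_1),\ y(T)\in(D_{-\rho})^c\},\qquad \underline{M^\delta}=\lim_{\rho\to0^+}M^\delta_\rho$$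 (the limit exists in $[0,\infty]$ because $M^\delta_\rho$ is nonincreasing in $\rho$). Then $$0<\inf_{\delta>0}\underline{M^\delta}\le\inf_{\delta>0}\overline{M^\delta}.$$ -/

import Mathlib

open MeasureTheory Filter Set
open scoped ENNReal Topology FourierTransform SchwartzMap LineDeriv

noncomputable section

namespace LogSchrodinger

/-- The space `ℝᵈ` with its Euclidean norm. -/
abbrev Space (d : ℕ) : Type := EuclideanSpace ℝ (Fin d)

/-- The space `H = L²(ℝᵈ; ℂ)`. -/
abbrev L2 (d : ℕ) : Type := Lp ℂ 2 (volume : Measure (Space d))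

/-- `v ∈ L²` is the weak (distributional) partial derivative `∂ⱼ u` of `u ∈ L²`. -/
def IsWeakDeriv {d : ℕ} (j : Fin d) (u v : L2 d) : Prop :=
  ∂_{(EuclideanSpace.single j (1 : ℝ) : Space d)} (u : 𝓢'(Space d, ℂ)) = (v : 𝓢'(Space d, ℂ))

/-- `w ∈ L²` is the function `(1 + |x|²)^{1/2} u`. -/
def IsWeighted {d : ℕ} (u w : L2 d) : Prop :=
  ∀ᵐ x : Space d, w x = (Real.sqrt (1 + ‖x‖ ^ 2) : ℂ) * u x

/-- The triples `(u, ∇u, (1 + |x|²)^{1/2} u)` of `L²` functions, in the `ℓ²` product. -/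
def graphX1 (d : ℕ) :
    Submodule ℂ (WithLp 2 (L2 d × WithLp 2 (PiLp 2 (fun _ : Fin d => L2 d) × L2 d))) where
  carrier := {z | (∀ j, IsWeakDeriv j z.fst (z.snd.fst j)) ∧ IsWeighted z.fst z.snd.snd}
  zero_mem' := by
    refine ⟨fun j => ?_, ?_⟩
    · have h0 : ((0 : L2 d) : 𝓢'(Space d, ℂ)) = 0 :=
        (Lp.toTemperedDistributionCLM ℂ (volume : Measure (Space d)) 2).map_zero
      change ∂_{_} ((0 : L2 d) : 𝓢'(Space d, ℂ)) = ((0 : L2 d) : 𝓢'(Space d, ℂ))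
      rw [h0]
      exact (LineDeriv.lineDerivOpCLM ℂ 𝓢'(Space d, ℂ)
        (EuclideanSpace.single j (1 : ℝ) : Space d)).map_zero
    · change ∀ᵐ x : Space d, (0 : L2 d) x = _ * (0 : L2 d) x
      filter_upwards [Lp.coeFn_zero ℂ 2 (volume : Measure (Space d))] with x hx
      rw [hx, Pi.zero_apply, mul_zero]
  add_mem' := by
    rintro a b ⟨ha, ha'⟩ ⟨hb, hb'⟩
    refine ⟨fun j => ?_, ?_⟩
    · have hadd : ∀ u v : L2 d, ((u + v : L2 d) : 𝓢'(Space d, ℂ)) = u + v :=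
        (Lp.toTemperedDistributionCLM ℂ (volume : Measure (Space d)) 2).map_add
      have h1 := ha j
      have h2 := hb j
      change ∂_{_} ((a.fst + b.fst : L2 d) : 𝓢'(Space d, ℂ)) =
        ((a.snd.fst j + b.snd.fst j : L2 d) : 𝓢'(Space d, ℂ))
      unfold IsWeakDeriv at h1 h2
      rw [hadd, hadd, LineDeriv.lineDerivOp_add, h1, h2]
    · change ∀ᵐ x : Space d, (a.snd.snd + b.snd.snd : L2 d) x = _ * (a.fst + b.fst : L2 d) x
      filter_upwards [ha', hb', Lp.coeFn_add a.fst b.fst, Lp.coeFn_add a.snd.snd b.snd.snd]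
        with x h1 h2 h3 h4
      rw [h3, h4, Pi.add_apply, Pi.add_apply, h1, h2, mul_add]
  smul_mem' := by
    rintro c a ⟨ha, ha'⟩
    refine ⟨fun j => ?_, ?_⟩
    · have hsmul : ∀ u : L2 d, ((c • u : L2 d) : 𝓢'(Space d, ℂ)) = c • (u : 𝓢'(Space d, ℂ)) :=
        (Lp.toTemperedDistributionCLM ℂ (volume : Measure (Space d)) 2).map_smul c
      have h1 := ha j
      change ∂_{_} ((c • a.fst : L2 d) : 𝓢'(Space d, ℂ)) =
        ((c • a.snd.fst j : L2 d) : 𝓢'(Space d, ℂ))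
      unfold IsWeakDeriv at h1
      rw [hsmul, hsmul, LineDeriv.lineDerivOp_smul, h1]
    · change ∀ᵐ x : Space d, (c • a.snd.snd : L2 d) x = _ * (c • a.fst : L2 d) x
      filter_upwards [ha', Lp.coeFn_smul c a.fst, Lp.coeFn_smul c a.snd.snd] with x h1 h3 h4
      rw [h3, h4, Pi.smul_apply, Pi.smul_apply, h1, smul_eq_mul, smul_eq_mul]
      ring

/-- The space `X₁ = H¹ ∩ L²₁`. A function `u` is recorded together with its weak gradient `∇u`
and with `(1 + |x|²)^{1/2} u`, which it determines (see `X1.ext_toL2`); the norm inherited from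
the product is `(‖u‖² + ‖∇u‖² + ‖(1 + |x|²)^{1/2} u‖²)^{1/2}`, see `X1.norm_sq`. -/
abbrev X1 (d : ℕ) : Type := graphX1 d

/-- The element of `X₁` regarded as a function in `L²`. -/
def X1.toL2 {d : ℕ} (u : X1 d) : L2 d := u.1.fst

/-- The weak partial derivative `∂ⱼ u` of `u ∈ X₁`. -/
def X1.deriv {d : ℕ} (u : X1 d) (j : Fin d) : L2 d := u.1.snd.fst j

/-- The function `(1 + |x|²)^{1/2} u` for `u ∈ X₁`. -/
def X1.weighted {d : ℕ} (u : X1 d) : L2 d := u.1.snd.snd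

theorem X1.norm_sq {d : ℕ} (u : X1 d) :
    ‖u‖ ^ 2 = (‖u.toL2‖ ^ 2 + ∑ j, ‖u.deriv j‖ ^ 2) + ‖u.weighted‖ ^ 2 := by
  change ‖u.1‖ ^ 2 = _
  rw [WithLp.prod_norm_sq_eq_of_L2, WithLp.prod_norm_sq_eq_of_L2, PiLp.norm_sq_eq_of_L2, add_assoc]
  rfl

theorem X1.ext_toL2 {d : ℕ} {u v : X1 d} (h : u.toL2 = v.toL2) : u = v := by
  have hinj : Function.Injective
      (Lp.toTemperedDistributionCLM ℂ (volume : Measure (Space d)) 2) :=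
    LinearMap.ker_eq_bot.mp Lp.ker_toTemperedDistributionCLM_eq_bot
  obtain ⟨u, hu, hu'⟩ := u
  obtain ⟨v, hv, hv'⟩ := v
  change u.fst = v.fst at h
  apply Subtype.ext
  change u = v
  have h1 : u.snd.fst = v.snd.fst := by
    ext1 j
    apply hinj
    have e1 := hu j
    have e2 := hv j
    unfold IsWeakDeriv at e1 e2
    rw [h] at e1
    exact e1.symm.trans e2
  have h2 : u.snd.snd = v.snd.snd := by
    apply Lp.ext
    rw [h] at hu'
    filter_upwards [hu', hv'] with x a b
    rw [a, b]
  exact WithLp.ofLp_injective 2 (Prod.ext h (WithLp.ofLp_injective 2 (Prod.ext h1 h2)))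

/-- The Fourier symbol `ξ ↦ exp(-4π² i τ |ξ|²)` of `exp(i τ Δ)`, for the Fourier transform
`𝓕 u (ξ) = ∫ exp(-2π i x·ξ) u(x) dx`. -/
def schrodingerSymbol (d : ℕ) (τ : ℝ) (ξ : Space d) : ℂ :=
  Complex.exp (((-(4 * Real.pi ^ 2 * τ * ‖ξ‖ ^ 2) : ℝ) : ℂ) * Complex.I)

theorem schrodingerSymbol_memLp (d : ℕ) (τ : ℝ) :
    MemLp (schrodingerSymbol d τ) ∞ (volume : Measure (Space d)) := by
  refine memLp_top_of_bound (C := 1) ?_ (ae_of_all _ fun ξ => ?_)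
  · have : Continuous (schrodingerSymbol d τ) := by
      unfold schrodingerSymbol
      fun_prop
    exact this.aestronglyMeasurable
  · rw [schrodingerSymbol, Complex.norm_exp_ofReal_mul_I]

/-- The Schrödinger group `exp(i τ Δ)` on `L²`, as a Fourier multiplier. -/
def schrodingerGroup {d : ℕ} (τ : ℝ) (u : L2 d) : L2 d :=
  𝓕⁻ (((schrodingerSymbol_memLp d τ).toLp _ • (𝓕 u : L2 d) : L2 d))

/-- The regularized logarithm `f_δ(r) = log ((δ + r) / (1 + δ r))`; it is applied to `r = |u|²`. -/
def regLog (δ r : ℝ) : ℝ := Real.log ((δ + r) / (1 + δ * r))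

theorem abs_regLog_le {δ r : ℝ} (hδ : 0 < δ) (hr : 0 ≤ r) : |regLog δ r| ≤ |Real.log δ| := by
  have h1 : 0 < 1 + δ * r := by positivity
  have h2 : 0 < (δ + r) / (1 + δ * r) := by positivity
  unfold regLog
  rcases le_total δ 1 with h | h
  · have a : Real.log δ ≤ Real.log ((δ + r) / (1 + δ * r)) := by
      apply Real.log_le_log hδ
      rw [le_div_iff₀ h1]
      nlinarith [mul_nonneg hr (sub_nonneg.2 h), mul_nonneg hδ.le (mul_nonneg hr (sub_nonneg.2 h))]
    have b : Real.log ((δ + r) / (1 + δ * r)) ≤ Real.log δ⁻¹ := by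
      apply Real.log_le_log h2
      rw [div_le_iff₀ h1, mul_add, ← mul_assoc, inv_mul_cancel₀ hδ.ne']
      have := (one_le_inv₀ hδ).2 h
      linarith
    rw [Real.log_inv] at b
    have c : Real.log δ ≤ 0 := Real.log_nonpos hδ.le h
    rw [abs_of_nonpos c, abs_le]
    constructor <;> linarith
  · have a : Real.log ((δ + r) / (1 + δ * r)) ≤ Real.log δ := by
      apply Real.log_le_log h2
      rw [div_le_iff₀ h1]
      nlinarith [mul_nonneg hr (sub_nonneg.2 h), mul_nonneg hδ.le (mul_nonneg hr (sub_nonneg.2 h))]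
    have b : Real.log δ⁻¹ ≤ Real.log ((δ + r) / (1 + δ * r)) := by
      apply Real.log_le_log (inv_pos.2 hδ)
      rw [le_div_iff₀ h1, mul_add, ← mul_assoc, inv_mul_cancel₀ hδ.ne']
      have := (inv_le_one₀ hδ).2 h
      linarith
    rw [Real.log_inv] at b
    have c : 0 ≤ Real.log δ := Real.log_nonneg h
    rw [abs_of_nonneg c, abs_le]
    constructor <;> linarith

theorem regLog_mul_memLp {d : ℕ} {δ : ℝ} (hδ : 0 < δ) (u : L2 d) :
    MemLp (fun x => (regLog δ (‖u x‖ ^ 2) : ℂ) * u x) 2 (volume : Measure (Space d)) := by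
  refine (Lp.memLp u).of_le_mul (c := |Real.log δ|) ?_ (ae_of_all _ fun x => ?_)
  · have hu : AEMeasurable u (volume : Measure (Space d)) :=
      (Lp.aestronglyMeasurable u).aemeasurable
    have : AEMeasurable (fun x => regLog δ (‖u x‖ ^ 2)) (volume : Measure (Space d)) := by
      unfold regLog
      fun_prop
    exact ((Complex.measurable_ofReal.comp_aemeasurable this).mul hu).aestronglyMeasurable
  · rw [norm_mul, Complex.norm_real, Real.norm_eq_abs]
    exact mul_le_mul_of_nonneg_right (abs_regLog_le hδ (by positivity)) (norm_nonneg _)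

/-- The nonlinearity `u ↦ f_δ(|u|²) u` on `L²`, for `δ > 0`. -/
def regLogMul {d : ℕ} (δ : Ioi (0 : ℝ)) (u : L2 d) : L2 d :=
  (regLog_mul_memLp δ.2 u).toLp _

/-- `g` belongs, on `[0, T]`, to the Cameron-Martin space of Brownian motion
(`g ∈ W^{1,2}([0, T]; ℝ)`, `g(0) = 0`) and `h ∈ L²([0, T])` is its derivative. -/
def IsControl (T : ℝ) (g h : ℝ → ℝ) : Prop :=
  MemLp h 2 (volume.restrict (Icc 0 T)) ∧ ∀ t ∈ Icc 0 T, g t = ∫ s in 0..t, h s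

/-- `y ∈ C([0, T]; X₁)` is the mild solution, driven by the control `g` and started at `u₀`, of
the skeleton equation `dy = i Δy dg + i λ f_δ(|y|²) y dt - α₁ y dt`, that is, `y = L^δ_{u₀}(g)`.
The equation is an identity in `L²`; both integrands are continuous in `s` for continuous `g`. Only
the values of `g` and `y` on `[0, T]` matter. -/
def IsSkeletonSolution {d : ℕ} (lam α₁ : ℝ) (δ : Ioi (0 : ℝ)) (T : ℝ) (u₀ : X1 d)
    (g : ℝ → ℝ) (y : ℝ → X1 d) : Prop :=
  ContinuousOn y (Icc 0 T) ∧ ∀ t ∈ Icc 0 T,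
    (y t).toL2 = schrodingerGroup (g t - g 0) u₀.toL2
      + (∫ s in 0..t, schrodingerGroup (g t - g s)
          ((Complex.I * (lam : ℂ)) • regLogMul δ (y s).toL2))
      - ∫ s in 0..t, schrodingerGroup (g t - g s) ((α₁ : ℂ) • (y s).toL2)

/-- The rate function `I^{δ,T}_{u₀}(y) = ½ inf {‖g‖² : L^δ_{u₀}(g) = y}`, where
`‖g‖² = ∫₀ᵀ |g'|²`; it is `+∞` if no control `g` produces `y`. -/
def rate {d : ℕ} (lam α₁ : ℝ) (δ : Ioi (0 : ℝ)) (T : ℝ) (u₀ : X1 d) (y : ℝ → X1 d) : ℝ≥0∞ :=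
  ⨅ (g : ℝ → ℝ) (h : ℝ → ℝ) (_ : IsControl T g h ∧ IsSkeletonSolution lam α₁ δ T u₀ g y),
    ENNReal.ofReal (1 / 2 * ∫ t in 0..T, |h t| ^ 2)

/-- The shrunk set `D_{-ρ}`: `D` without the open `ρ`-neighbourhood of its boundary. -/
def shrink {d : ℕ} (D : Set (X1 d)) (ρ : ℝ) : Set (X1 d) := D \ Metric.thickening ρ (frontier D)

/-- `M̄^δ`, the least cost of a path from `0` that ends outside the closure of `D`. -/
def upperM {d : ℕ} (lam α₁ : ℝ) (δ : Ioi (0 : ℝ)) (D : Set (X1 d)) : ℝ≥0∞ :=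
  ⨅ (T : ℝ) (y : ℝ → X1 d) (_ : 0 < T ∧ y T ∈ (closure D)ᶜ), rate lam α₁ δ T 0 y

/-- `M^δ_ρ`, the least cost of a path from the closed `ρ`-ball that ends outside `D_{-ρ}`. -/
def ballM {d : ℕ} (lam α₁ : ℝ) (δ : Ioi (0 : ℝ)) (D : Set (X1 d)) (ρ : ℝ) : ℝ≥0∞ :=
  ⨅ (u₀ : X1 d) (T : ℝ) (y : ℝ → X1 d) (_ : ‖u₀‖ ≤ ρ ∧ 0 < T ∧ y T ∈ (shrink D ρ)ᶜ),
    rate lam α₁ δ T u₀ y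

/-- `M̲^δ`, the limit of `M^δ_ρ` as `ρ → 0+`; the limit exists, see `tendsto_ballM`. -/
def lowerM {d : ℕ} (lam α₁ : ℝ) (δ : Ioi (0 : ℝ)) (D : Set (X1 d)) : ℝ≥0∞ :=
  limUnder (𝓝[>] (0 : ℝ)) (ballM lam α₁ δ D)

theorem tendsto_ballM {d : ℕ} (lam α₁ : ℝ) (δ : Ioi (0 : ℝ)) (D : Set (X1 d)) :
    Tendsto (ballM lam α₁ δ D) (𝓝[>] (0 : ℝ)) (𝓝 (lowerM lam α₁ δ D)) := by
  have hanti : Antitone (ballM lam α₁ δ D) := by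
    intro ρ ρ' h
    refine le_iInf fun u₀ => le_iInf fun T => le_iInf fun y => le_iInf fun hy => ?_
    refine iInf_le_of_le u₀ (iInf_le_of_le T (iInf_le_of_le y (iInf_le_of_le ?_ le_rfl)))
    exact ⟨hy.1.trans h, hy.2.1, fun hm => hy.2.2
      ⟨hm.1, fun hn => hm.2 (Metric.thickening_mono h _ hn)⟩⟩
  exact tendsto_nhds_limUnder ⟨_, hanti.tendsto_nhdsGT 0⟩

end LogSchrodinger

end

/-!
Paths that start in a small ball of `X₁` and have cost below `1` stay near `0`, uniformly in the
time horizon and in `δ`; hence `1 ≤ M^δ_ρ` for one `ρ` and all `δ` (`exists_one_le_ballM`). The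
comparison with the upper quantity is immediate, since a path from `0` that leaves the closure of
`D` also leaves every shrunk set (`ballM_le_upperM`).

The bound on the paths rests on a single contraction estimate in `L²`. Write the equation in the
interaction picture, `p(t) = exp(-i g(t) Δ) y(t)`; then `p' = exp(-i g Δ) N(y)` with
`N(u) = i λ f_δ(|u|²) u - α₁ u`, and `g` need not be differentiated. As `f_δ` is `1`-Lipschitz in
`log r`, the map `N` satisfies
`Re ⟪u - v, N u - N v⟫ ≤ -κ ‖u - v‖²` with `κ = α₁ - 2 |λ| > 0` (`inner_forcing_sub_le`).
Consequently, if operators `U(t)` commute with `N` and are carried into one another by the group,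
then `‖U(t) y(t) - y(t)‖ ≤ exp(-κ t) ‖U(0) u₀ - u₀‖`
(`IsSkeletonSolution.norm_symmetry_sub_le`). Three families of symmetries give the three parts of
the norm of `X₁`:

* `u ↦ -u` gives the decay of `‖y‖`;
* translations by `a eⱼ`, divided by `a → 0`, give the decay of `‖∂ⱼ y‖`;
* modulations by `exp (2π i h xⱼ)` are carried by the group into modulations composed with a
  translation by `-4π g(t) h eⱼ` and a constant phase (`schrodinger_modulate`, Galilean
  covariance). Division by `h → 0` gives
  `‖2π xⱼ y(t)‖ ≤ exp(-κ t) ‖2π xⱼ u₀‖ + 4π |g(t)| ‖∂ⱼ y(t)‖`, and `|g(t)|`, which grows at most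
  linearly in `t` for bounded energy, is absorbed by the decay of `‖∂ⱼ y(t)‖`.

The passage between difference quotients and derivatives or weights is an elementary estimate in
one direction and Fatou's lemma in the other, on the Fourier side for derivatives.
-/

namespace LogSchrodinger

noncomputable section

variable {d : ℕ}

/-! ### Unimodular multiplications and translations on `L²` -/

theorem memLp_phase_mul {φ : Space d → ℝ} (hφ : Measurable φ) (u : L2 d) :
    MemLp (fun x => Complex.exp (φ x * Complex.I) * u x) 2 (volume : Measure (Space d)) := by
  refine (Lp.memLp u).of_le ?_ (ae_of_all _ fun x => ?_)
  · have h : Measurable fun x => Complex.exp (φ x * Complex.I) := by fun_prop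
    exact h.aestronglyMeasurable.mul (Lp.aestronglyMeasurable u)
  · rw [norm_mul, Complex.norm_exp_ofReal_mul_I, one_mul]

/-- Multiplication by the unimodular function `exp (i φ)` on `L²`, for a measurable real phase
`φ`. -/
def phaseMul (φ : Space d → ℝ) (hφ : Measurable φ) : L2 d →ₗᵢ[ℂ] L2 d where
  toFun u := (memLp_phase_mul hφ u).toLp _
  map_add' u v := by
    apply Lp.ext
    filter_upwards [(memLp_phase_mul hφ (u + v)).coeFn_toLp, (memLp_phase_mul hφ u).coeFn_toLp,
      (memLp_phase_mul hφ v).coeFn_toLp, Lp.coeFn_add u v,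
      Lp.coeFn_add ((memLp_phase_mul hφ u).toLp _) ((memLp_phase_mul hφ v).toLp _)]
      with x h1 h2 h3 h4 h5
    rw [h1, h5, Pi.add_apply, h2, h3, h4, Pi.add_apply, mul_add]
  map_smul' c u := by
    apply Lp.ext
    filter_upwards [(memLp_phase_mul hφ (c • u)).coeFn_toLp, (memLp_phase_mul hφ u).coeFn_toLp,
      Lp.coeFn_smul c u, Lp.coeFn_smul c ((memLp_phase_mul hφ u).toLp _)] with x h1 h2 h3 h4
    rw [h1, RingHom.id_apply, h4, Pi.smul_apply, h2, h3, Pi.smul_apply, smul_eq_mul, smul_eq_mul]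
    ring
  norm_map' u := by
    change ‖(memLp_phase_mul hφ u).toLp _‖ = ‖u‖
    apply le_antisymm <;> apply Lp.norm_le_norm_of_ae_le <;>
      filter_upwards [(memLp_phase_mul hφ u).coeFn_toLp] with x h1 <;>
      rw [h1, norm_mul, Complex.norm_exp_ofReal_mul_I, one_mul]

theorem coeFn_phaseMul {φ : Space d → ℝ} (hφ : Measurable φ) (u : L2 d) :
    ∀ᵐ x, phaseMul φ hφ u x = Complex.exp (φ x * Complex.I) * u x :=
  (memLp_phase_mul hφ u).coeFn_toLp

theorem phaseMul_phaseMul {φ ψ : Space d → ℝ} (hφ : Measurable φ) (hψ : Measurable ψ) (u : L2 d) :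
    phaseMul φ hφ (phaseMul ψ hψ u) = phaseMul (fun x => φ x + ψ x) (hφ.add hψ) u := by
  apply Lp.ext
  filter_upwards [coeFn_phaseMul hφ (phaseMul ψ hψ u), coeFn_phaseMul hψ u,
    coeFn_phaseMul (φ := fun x => φ x + ψ x) (hφ.add hψ) u] with x h1 h2 h3
  rw [h1, h2, h3, Complex.ofReal_add, add_mul, Complex.exp_add, mul_assoc]

theorem phaseMul_congr {φ ψ : Space d → ℝ} (hφ : Measurable φ) (hψ : Measurable ψ) (h : φ = ψ)
    (u : L2 d) : phaseMul φ hφ u = phaseMul ψ hψ u := by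
  subst h
  rfl

/-- The translation `u ↦ u(· + a)` on `L²`. -/
def translate (a : Space d) : L2 d →ₗᵢ[ℂ] L2 d where
  toFun u := Lp.compMeasurePreserving (· + a) (measurePreserving_add_right volume a) u
  map_add' u v := map_add _ u v
  map_smul' c u := by
    apply Lp.ext
    have hm := measurePreserving_add_right (volume : Measure (Space d)) a
    filter_upwards [Lp.coeFn_compMeasurePreserving (c • u) hm,
      Lp.coeFn_compMeasurePreserving u hm,
      Lp.coeFn_smul c (Lp.compMeasurePreserving _ hm u),
      hm.quasiMeasurePreserving.ae (Lp.coeFn_smul c u)] with x h1 h2 h3 h4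
    rw [h1, RingHom.id_apply, h3, Pi.smul_apply, h2]
    exact h4
  norm_map' u := Lp.norm_compMeasurePreserving u _

theorem coeFn_translate (a : Space d) (u : L2 d) : ∀ᵐ x, translate a u x = u (x + a) :=
  Lp.coeFn_compMeasurePreserving u (measurePreserving_add_right volume a)

theorem ae_comp_add_right {p : Space d → Prop} (h : ∀ᵐ x, p x) (a : Space d) :
    ∀ᵐ x, p (x + a) :=
  (measurePreserving_add_right (volume : Measure (Space d)) a).quasiMeasurePreserving.ae h

theorem translate_phaseMul {φ : Space d → ℝ} (hφ : Measurable φ) (a : Space d) (u : L2 d) :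
    translate a (phaseMul φ hφ u) =
      phaseMul (fun x => φ (x + a)) (hφ.comp (measurable_add_const a)) (translate a u) := by
  apply Lp.ext
  filter_upwards [coeFn_translate a (phaseMul φ hφ u), ae_comp_add_right (coeFn_phaseMul hφ u) a,
    coeFn_phaseMul (hφ.comp (measurable_add_const a)) (translate a u), coeFn_translate a u]
    with x h1 h2 h3 h4
  rw [h1, h2]
  exact (h3.trans (by rw [h4]; rfl)).symm

/-- The plane-wave phase `x ↦ 2π ⟪x, b⟫`. -/
def wave (b : Space d) (x : Space d) : ℝ := 2 * Real.pi * inner ℝ x b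

@[fun_prop]
theorem measurable_wave (b : Space d) : Measurable (wave b) := by
  unfold wave
  fun_prop

/-- The modulation `u ↦ exp (2π i ⟪·, b⟫) u` on `L²`. -/
abbrev modulate (b : Space d) : L2 d →ₗᵢ[ℂ] L2 d := phaseMul (wave b) (measurable_wave b)

/-! ### Translations and modulations under the Fourier transform -/

theorem translate_toLp (a : Space d) (f : 𝓢(Space d, ℂ)) :
    translate a (f.toLp 2) = (f.compSubConstCLM ℂ (-a)).toLp 2 := by
  apply Lp.ext
  filter_upwards [coeFn_translate a (f.toLp 2), (f.compSubConstCLM ℂ (-a)).coeFn_toLp 2 volume,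
    ae_comp_add_right (f.coeFn_toLp 2 volume) a] with x h1 h2 h3
  rw [h1, h2, h3, SchwartzMap.compSubConstCLM_apply, sub_neg_eq_add]

theorem fourier_comp_add_right (a : Space d) (f : Space d → ℂ) (ξ : Space d) :
    𝓕 (fun x => f (x + a)) ξ = Complex.exp (wave a ξ * Complex.I) * 𝓕 f ξ := by
  have h := congrFun (VectorFourier.fourierIntegral_comp_add_right Real.fourierChar volume
    (innerₗ (Space d)) f a) ξ
  refine h.trans ?_
  rw [Circle.smul_def, smul_eq_mul, Real.fourierChar_apply]
  congr 3
  simp [wave, real_inner_comm]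

theorem fourier_translate (a : Space d) (u : L2 d) :
    𝓕 (translate a u) = modulate a (𝓕 u) := by
  refine DenseRange.induction_on (p := fun u : L2 d => 𝓕 (translate a u) = modulate a (𝓕 u))
    (SchwartzMap.denseRange_toLpCLM (p := 2) ENNReal.ofNat_ne_top) u ?_ fun f => ?_
  · exact isClosed_eq
      ((Lp.fourierTransformₗᵢ _ _).continuous.comp (translate a).continuous)
      ((modulate a).continuous.comp (Lp.fourierTransformₗᵢ _ _).continuous)
  · change 𝓕 (translate a (f.toLp 2)) = modulate a (𝓕 (f.toLp 2))
    rw [translate_toLp, SchwartzMap.toLp_fourier_eq, SchwartzMap.toLp_fourier_eq]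
    apply Lp.ext
    filter_upwards [(𝓕 (f.compSubConstCLM ℂ (-a))).coeFn_toLp 2 volume,
      (𝓕 f).coeFn_toLp 2 volume, coeFn_phaseMul (measurable_wave a) ((𝓕 f).toLp 2)]
      with x h1 h2 h3
    rw [h1, h3, h2, SchwartzMap.fourier_coe, SchwartzMap.fourier_coe, ← fourier_comp_add_right]
    rw [show ⇑(f.compSubConstCLM ℂ (-a)) = fun y => f (y + a) by funext y; simp]

theorem fourierInv_translate (a : Space d) (u : L2 d) :
    𝓕⁻ (translate a u) = modulate (-a) (𝓕⁻ u) := by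
  refine DenseRange.induction_on (p := fun u : L2 d => 𝓕⁻ (translate a u) = modulate (-a) (𝓕⁻ u))
    (SchwartzMap.denseRange_toLpCLM (p := 2) ENNReal.ofNat_ne_top) u ?_ fun f => ?_
  · exact isClosed_eq
      ((Lp.fourierTransformₗᵢ _ _).symm.continuous.comp (translate a).continuous)
      ((modulate (-a)).continuous.comp (Lp.fourierTransformₗᵢ _ _).symm.continuous)
  · change 𝓕⁻ (translate a (f.toLp 2)) = modulate (-a) (𝓕⁻ (f.toLp 2))
    rw [translate_toLp, SchwartzMap.toLp_fourierInv_eq, SchwartzMap.toLp_fourierInv_eq]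
    apply Lp.ext
    filter_upwards [(𝓕⁻ (f.compSubConstCLM ℂ (-a))).coeFn_toLp 2 volume,
      (𝓕⁻ f).coeFn_toLp 2 volume, coeFn_phaseMul (measurable_wave (-a)) ((𝓕⁻ f).toLp 2)]
      with x h1 h2 h3
    have hw : wave (-a) x = wave a (-x) := by simp [wave]
    rw [h1, h3, h2, SchwartzMap.fourierInv_coe, SchwartzMap.fourierInv_coe,
      Real.fourierInv_eq_fourier_neg, Real.fourierInv_eq_fourier_neg, hw, ← fourier_comp_add_right]
    rw [show ⇑(f.compSubConstCLM ℂ (-a)) = fun y => f (y + a) by funext y; simp]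

theorem fourier_modulate (b : Space d) (u : L2 d) :
    𝓕 (modulate b u) = translate (-b) (𝓕 u) := by
  have h := fourierInv_translate (-b) (𝓕 u)
  rw [neg_neg, FourierTransform.fourierInv_fourier_eq] at h
  rw [← h, FourierTransform.fourier_fourierInv_eq]

/-! ### The Schrödinger group -/

/-- The phase of the Fourier symbol of `exp(i τ Δ)`. -/
def dispersion (τ : ℝ) (ξ : Space d) : ℝ := -(4 * Real.pi ^ 2 * τ * ‖ξ‖ ^ 2)

@[fun_prop]
theorem measurable_dispersion (τ : ℝ) : Measurable (dispersion τ : Space d → ℝ) := by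
  unfold dispersion
  fun_prop

theorem fourier_schrodingerGroup (τ : ℝ) (u : L2 d) :
    𝓕 (schrodingerGroup τ u) = phaseMul (dispersion τ) (measurable_dispersion τ) (𝓕 u) := by
  rw [schrodingerGroup, FourierTransform.fourier_fourierInv_eq]
  apply Lp.ext
  filter_upwards [coeFn_phaseMul (measurable_dispersion τ) (𝓕 u),
    Lp.coeFn_lpSMul (r := 2) ((schrodingerSymbol_memLp d τ).toLp _) (𝓕 u),
    (schrodingerSymbol_memLp d τ).coeFn_toLp] with x h1 h2 h3
  rw [h1, h2, Pi.smul_apply', h3, smul_eq_mul]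
  rfl

theorem fourier_injective {u v : L2 d} (h : 𝓕 u = 𝓕 v) : u = v :=
  (Lp.fourierTransformₗᵢ (Space d) ℂ).injective h

/-- The Schrödinger group as a linear isometry of `L²`. -/
def schrodinger (τ : ℝ) : L2 d →ₗᵢ[ℂ] L2 d :=
  (Lp.fourierTransformₗᵢ (Space d) ℂ).symm.toLinearIsometry.comp
    ((phaseMul (dispersion τ) (measurable_dispersion τ)).comp
      (Lp.fourierTransformₗᵢ (Space d) ℂ).toLinearIsometry)

theorem fourier_schrodinger (τ : ℝ) (u : L2 d) :
    𝓕 (schrodinger τ u) = phaseMul (dispersion τ) (measurable_dispersion τ) (𝓕 u) :=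
  (Lp.fourierTransformₗᵢ (Space d) ℂ).apply_symm_apply _

theorem schrodingerGroup_eq (τ : ℝ) (u : L2 d) : schrodingerGroup τ u = schrodinger τ u :=
  fourier_injective ((fourier_schrodingerGroup τ u).trans (fourier_schrodinger τ u).symm)

theorem schrodinger_schrodinger (σ τ : ℝ) (u : L2 d) :
    schrodinger σ (schrodinger τ u) = schrodinger (σ + τ) u := by
  apply fourier_injective
  rw [fourier_schrodinger, fourier_schrodinger, fourier_schrodinger, phaseMul_phaseMul]
  apply phaseMul_congr
  ext ξ
  simp only [dispersion]
  ring

theorem schrodinger_zero (u : L2 d) : schrodinger 0 u = u := by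
  apply fourier_injective
  rw [fourier_schrodinger]
  apply Lp.ext
  filter_upwards [coeFn_phaseMul (measurable_dispersion 0) (𝓕 u)] with x hx
  rw [hx]
  simp [dispersion]

theorem schrodinger_translate (τ : ℝ) (a : Space d) (u : L2 d) :
    schrodinger τ (translate a u) = translate a (schrodinger τ u) := by
  apply fourier_injective
  rw [fourier_schrodinger, fourier_translate, fourier_translate, fourier_schrodinger,
    phaseMul_phaseMul, phaseMul_phaseMul]
  exact phaseMul_congr _ _ (by ext ξ; ring) _

/-- Galilean covariance: `exp(i τ Δ)` turns a modulation into a modulation, a translation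
proportional to `τ` and a constant phase. -/
theorem schrodinger_modulate (τ : ℝ) (b : Space d) (u : L2 d) :
    schrodinger τ (modulate b u) =
      phaseMul (fun _ => -(4 * Real.pi ^ 2 * τ * ‖b‖ ^ 2)) measurable_const
        (modulate b (translate (-(4 * Real.pi * τ) • b) (schrodinger τ u))) := by
  apply fourier_injective
  have hc : ∀ v : L2 d, 𝓕 (phaseMul (fun _ => -(4 * Real.pi ^ 2 * τ * ‖b‖ ^ 2))
      measurable_const v) = phaseMul (fun _ => -(4 * Real.pi ^ 2 * τ * ‖b‖ ^ 2))
      measurable_const (𝓕 v) := by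
    intro v
    have h : ∀ v : L2 d, phaseMul (fun _ => -(4 * Real.pi ^ 2 * τ * ‖b‖ ^ 2)) measurable_const v =
        Complex.exp ((-(4 * Real.pi ^ 2 * τ * ‖b‖ ^ 2) : ℝ) * Complex.I) • v := by
      intro v
      apply Lp.ext
      filter_upwards [coeFn_phaseMul (d := d) (φ := fun _ => -(4 * Real.pi ^ 2 * τ * ‖b‖ ^ 2))
        measurable_const v, Lp.coeFn_smul
          (Complex.exp ((-(4 * Real.pi ^ 2 * τ * ‖b‖ ^ 2) : ℝ) * Complex.I)) v] with x h1 h2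
      rw [h1, h2, Pi.smul_apply, smul_eq_mul]
    rw [h, h]
    exact (Lp.fourierTransformₗᵢ (Space d) ℂ).map_smul _ v
  rw [hc, fourier_schrodinger, fourier_modulate, fourier_modulate, fourier_translate,
    fourier_schrodinger, translate_phaseMul, translate_phaseMul, phaseMul_phaseMul,
    phaseMul_phaseMul]
  apply phaseMul_congr
  ext ξ
  simp only [wave, dispersion]
  rw [← sub_eq_add_neg ξ b, norm_sub_sq_real, inner_smul_right, inner_sub_left,
    real_inner_self_eq_norm_sq]
  ring

theorem norm_sq_eq_integral (u : L2 d) : ‖u‖ ^ 2 = ∫ x, ‖u x‖ ^ 2 := by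
  have h := norm_sq_eq_re_inner (𝕜 := ℂ) u
  rw [L2.inner_def] at h
  have h2 : ∀ x, inner ℂ (u x) (u x) = ((‖u x‖ ^ 2 : ℝ) : ℂ) := fun x => by
    rw [inner_self_eq_norm_sq_to_K]
    norm_cast
  simp_rw [h2] at h
  rw [h, integral_complex_ofReal]
  exact Complex.ofReal_re _

theorem integrable_norm_sq (u : L2 d) : Integrable fun x => ‖u x‖ ^ 2 :=
  (memLp_two_iff_integrable_sq_norm (Lp.aestronglyMeasurable u)).1 (Lp.memLp u)

/-- Strong continuity of a family of unimodular multiplications, by dominated convergence. -/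
theorem continuous_phaseMul {φ : ℝ → Space d → ℝ} (hφ : ∀ τ, Measurable (φ τ))
    (hc : ∀ x, Continuous fun τ => φ τ x) (u : L2 d) :
    Continuous fun τ => phaseMul (φ τ) (hφ τ) u := by
  rw [continuous_iff_continuousAt]
  intro τ₀
  rw [ContinuousAt, tendsto_iff_norm_sub_tendsto_zero]
  have hsq : ∀ τ, ‖phaseMul (φ τ) (hφ τ) u - phaseMul (φ τ₀) (hφ τ₀) u‖ ^ 2 =
      ∫ x, ‖(Complex.exp (φ τ x * Complex.I) - Complex.exp (φ τ₀ x * Complex.I)) * u x‖ ^ 2 := by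
    intro τ
    rw [norm_sq_eq_integral]
    apply integral_congr_ae
    filter_upwards [coeFn_phaseMul (hφ τ) u, coeFn_phaseMul (hφ τ₀) u, Lp.coeFn_sub
      (phaseMul (φ τ) (hφ τ) u) (phaseMul (φ τ₀) (hφ τ₀) u)] with x h1 h2 h3
    rw [h3, Pi.sub_apply, h1, h2, sub_mul]
  have hlim : Tendsto (fun τ => ∫ x,
      ‖(Complex.exp (φ τ x * Complex.I) - Complex.exp (φ τ₀ x * Complex.I)) * u x‖ ^ 2) (𝓝 τ₀)
      (𝓝 (∫ _ : Space d, (0 : ℝ))) := by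
    refine tendsto_integral_filter_of_dominated_convergence (fun x => 4 * ‖u x‖ ^ 2)
      (Eventually.of_forall fun τ => ?_) (Eventually.of_forall fun τ => ae_of_all _ fun x => ?_)
      ((integrable_norm_sq u).const_mul 4) (ae_of_all _ fun x => ?_)
    · have h : Measurable fun x => Complex.exp (φ τ x * Complex.I) -
          Complex.exp (φ τ₀ x * Complex.I) := by
        have := hφ τ
        have := hφ τ₀
        fun_prop
      exact (h.aestronglyMeasurable.mul (Lp.aestronglyMeasurable u)).norm.pow 2
    · have h : ‖Complex.exp (φ τ x * Complex.I) - Complex.exp (φ τ₀ x * Complex.I)‖ ≤ 2 := by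
        refine (norm_sub_le _ _).trans ?_
        rw [Complex.norm_exp_ofReal_mul_I, Complex.norm_exp_ofReal_mul_I]
        norm_num
      rw [Real.norm_eq_abs, abs_of_nonneg (by positivity), norm_mul, mul_pow]
      have := pow_le_pow_left₀ (norm_nonneg _) h 2
      nlinarith [sq_nonneg ‖u x‖]
    · have h : Continuous fun τ =>
          ‖(Complex.exp (φ τ x * Complex.I) - Complex.exp (φ τ₀ x * Complex.I)) * u x‖ ^ 2 := by
        have := hc x
        fun_prop
      simpa using h.tendsto τ₀
  simp_rw [← hsq, integral_zero] at hlim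
  have h := (Real.continuous_sqrt.tendsto 0).comp hlim
  simpa [Function.comp_def] using h

theorem continuous_schrodinger (u : L2 d) : Continuous fun τ => schrodinger τ u :=
  (Lp.fourierTransformₗᵢ (Space d) ℂ).symm.continuous.comp
    (continuous_phaseMul measurable_dispersion
      (fun x => by unfold dispersion; fun_prop) (𝓕 u))

/-- Joint continuity of `(τ, u) ↦ exp(i τ Δ) u`, along a curve. -/
theorem continuousOn_schrodinger {s : Set ℝ} {τ : ℝ → ℝ} {u : ℝ → L2 d} (hτ : ContinuousOn τ s)
    (hu : ContinuousOn u s) : ContinuousOn (fun t => schrodinger (τ t) (u t)) s := by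
  intro t ht
  rw [ContinuousWithinAt, tendsto_iff_norm_sub_tendsto_zero]
  have h1 : Tendsto (fun r => ‖u r - u t‖) (𝓝[s] t) (𝓝 0) :=
    tendsto_iff_norm_sub_tendsto_zero.1 (hu t ht)
  have h2 : Tendsto (fun r => ‖schrodinger (τ r) (u t) -
      schrodinger (τ t) (u t)‖) (𝓝[s] t) (𝓝 0) :=
    tendsto_iff_norm_sub_tendsto_zero.1
      (((continuous_schrodinger (u t)).tendsto (τ t)).comp (hτ t ht))
  refine squeeze_zero (fun _ => norm_nonneg _) (fun r => ?_) (by simpa using h1.add h2)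
  rw [← (schrodinger (τ r)).norm_map (u r - u t), map_sub]
  exact norm_sub_le_norm_sub_add_norm_sub _ _ _

/-! ### The logarithmic nonlinearity -/

/-- `f_δ` is `1`-Lipschitz as a function of `log r`. -/
theorem abs_regLog_sub_regLog_le {δ r s : ℝ} (hδ : 0 < δ) (hs : 0 < s) (hsr : s ≤ r) :
    |regLog δ r - regLog δ s| ≤ Real.log (r / s) := by
  have hr : 0 < r := hs.trans_le hsr
  have e : ∀ q, 0 < q → regLog δ q = Real.log (δ + q) - Real.log (1 + δ * q) := fun q hq => by
    rw [regLog, Real.log_div (by positivity) (by positivity)]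
  rw [e r hr, e s hs, Real.log_div hr.ne' hs.ne']
  have h1 : Real.log (δ + s) ≤ Real.log (δ + r) := Real.log_le_log (by positivity) (by linarith)
  have h2 : Real.log (1 + δ * s) ≤ Real.log (1 + δ * r) :=
    Real.log_le_log (by positivity) (by nlinarith)
  have h3 : Real.log (δ + r) + Real.log s ≤ Real.log (δ + s) + Real.log r := by
    rw [← Real.log_mul (by positivity) (by positivity), ← Real.log_mul (by positivity)
      (by positivity)]
    exact Real.log_le_log (by positivity) (by nlinarith)
  have h4 : Real.log (1 + δ * r) + Real.log s ≤ Real.log (1 + δ * s) + Real.log r := by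
    rw [← Real.log_mul (by positivity) (by positivity), ← Real.log_mul (by positivity)
      (by positivity)]
    exact Real.log_le_log (by positivity) (by nlinarith)
  rw [abs_le]
  constructor <;> linarith

/-- The singularity of the logarithm at `0` is compensated by the smaller of the two moduli. -/
theorem abs_regLog_sq_sub_mul_le {δ a b : ℝ} (hδ : 0 < δ) (hb : 0 ≤ b) (hba : b ≤ a) :
    |regLog δ (a ^ 2) - regLog δ (b ^ 2)| * b ≤ 2 * (a - b) := by
  rcases hb.eq_or_lt with rfl | hb
  · rw [mul_zero]
    linarith
  have h1 := abs_regLog_sub_regLog_le hδ (pow_pos hb 2) (pow_le_pow_left₀ hb.le hba 2)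
  rw [← div_pow, Real.log_pow] at h1
  have h2 := Real.log_le_sub_one_of_pos (div_pos (hb.trans_le hba) hb)
  push_cast at h1
  calc |regLog δ (a ^ 2) - regLog δ (b ^ 2)| * b ≤ (2 * (a / b - 1)) * b := by
        gcongr
        linarith
    _ = 2 * (a - b) := by
        field_simp

theorem regLog_mul_sub (δ : ℝ) (z w : ℂ) :
    (regLog δ (‖z‖ ^ 2) : ℂ) * z - regLog δ (‖w‖ ^ 2) * w =
      regLog δ (‖z‖ ^ 2) * (z - w) + ((regLog δ (‖z‖ ^ 2) - regLog δ (‖w‖ ^ 2) : ℝ) : ℂ) * w := by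
  push_cast
  ring

theorem norm_regLog_sub_mul_le {δ : ℝ} (hδ : 0 < δ) {z w : ℂ} (h : ‖w‖ ≤ ‖z‖) :
    ‖((regLog δ (‖z‖ ^ 2) - regLog δ (‖w‖ ^ 2) : ℝ) : ℂ) * w‖ ≤ 2 * ‖z - w‖ := by
  rw [norm_mul, Complex.norm_real, Real.norm_eq_abs]
  exact (abs_regLog_sq_sub_mul_le hδ (norm_nonneg w) h).trans
    (mul_le_mul_of_nonneg_left (norm_sub_norm_le z w) two_pos.le)

theorem norm_regLog_mul_sub_le {δ : ℝ} (hδ : 0 < δ) (z w : ℂ) :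
    ‖(regLog δ (‖z‖ ^ 2) : ℂ) * z - regLog δ (‖w‖ ^ 2) * w‖ ≤
      (|Real.log δ| + 2) * ‖z - w‖ := by
  wlog h : ‖w‖ ≤ ‖z‖ generalizing z w
  · rw [norm_sub_rev, norm_sub_rev z w]
    exact this w z (le_of_not_ge h)
  rw [regLog_mul_sub, add_mul]
  refine (norm_add_le _ _).trans (add_le_add ?_ (norm_regLog_sub_mul_le hδ h))
  rw [norm_mul, Complex.norm_real, Real.norm_eq_abs]
  exact mul_le_mul_of_nonneg_right (abs_regLog_le hδ (by positivity)) (norm_nonneg _)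

/-- One-sided Lipschitz bound for the logarithmic nonlinearity, with a constant independent of
`δ`: in the difference of the two products the summand `f_δ(|z|²) (z - w)` is, after
multiplication by `i λ`, orthogonal to `z - w`. -/
theorem re_inner_regLog_sub_le {δ : ℝ} (hδ : 0 < δ) (lam α₁ : ℝ) (z w : ℂ) :
    (inner ℂ (z - w) ((Complex.I * lam * (regLog δ (‖z‖ ^ 2) * z) - α₁ * z) -
      (Complex.I * lam * (regLog δ (‖w‖ ^ 2) * w) - α₁ * w))).re ≤
      -(α₁ - 2 * |lam|) * ‖z - w‖ ^ 2 := by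
  wlog h : ‖w‖ ≤ ‖z‖ generalizing z w
  · have := this w z (le_of_not_ge h)
    rw [norm_sub_rev w z, ← neg_sub z w, inner_neg_left, ← inner_neg_right, neg_sub] at this
    exact this
  set e := ((regLog δ (‖z‖ ^ 2) - regLog δ (‖w‖ ^ 2) : ℝ) : ℂ) * w with he
  have h1 : ‖e‖ ≤ 2 * ‖z - w‖ := norm_regLog_sub_mul_le hδ h
  have h2 : (Complex.I * lam * (regLog δ (‖z‖ ^ 2) * z) - α₁ * z) -
      (Complex.I * lam * (regLog δ (‖w‖ ^ 2) * w) - α₁ * w) =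
      (((lam * regLog δ (‖z‖ ^ 2) : ℝ) : ℂ) * Complex.I - α₁) * (z - w)
        + (Complex.I * lam) * e := by
    rw [he]
    push_cast
    ring
  have h3 : (inner ℂ (z - w) ((((lam * regLog δ (‖z‖ ^ 2) : ℝ) : ℂ) * Complex.I - α₁) *
      (z - w))).re = -α₁ * ‖z - w‖ ^ 2 := by
    rw [← smul_eq_mul, inner_smul_right, inner_self_eq_norm_sq_to_K]
    have : ((‖z - w‖ : ℂ)) ^ 2 = ((‖z - w‖ ^ 2 : ℝ) : ℂ) := by push_cast; rfl
    change ((_ - _) * ((‖z - w‖ : ℂ)) ^ 2).re = _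
    rw [this, Complex.re_mul_ofReal]
    simp
  have h4 : (inner ℂ (z - w) ((Complex.I * lam) * e)).re ≤ 2 * |lam| * ‖z - w‖ ^ 2 := by
    refine (Complex.re_le_norm _).trans ((norm_inner_le_norm _ _).trans ?_)
    rw [norm_mul, norm_mul, Complex.norm_I, Complex.norm_real, Real.norm_eq_abs, one_mul]
    calc ‖z - w‖ * (|lam| * ‖e‖) ≤ ‖z - w‖ * (|lam| * (2 * ‖z - w‖)) := by gcongr
      _ = 2 * |lam| * ‖z - w‖ ^ 2 := by ring
  rw [h2, inner_add_right, Complex.add_re, h3]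
  linarith

theorem coeFn_regLogMul (δ : Ioi (0 : ℝ)) (u : L2 d) :
    ∀ᵐ x, regLogMul δ u x = (regLog δ (‖u x‖ ^ 2) : ℂ) * u x :=
  (regLog_mul_memLp δ.2 u).coeFn_toLp

theorem continuous_regLogMul (δ : Ioi (0 : ℝ)) : Continuous (regLogMul δ : L2 d → L2 d) := by
  refine (LipschitzWith.of_dist_le_mul (K := ⟨|Real.log δ| + 2, by positivity⟩)
    fun u v => ?_).continuous
  rw [dist_eq_norm, dist_eq_norm]
  apply Lp.norm_le_mul_norm_of_ae_le_mul
  filter_upwards [coeFn_regLogMul δ u, coeFn_regLogMul δ v, Lp.coeFn_sub u v,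
    Lp.coeFn_sub (regLogMul δ u) (regLogMul δ v)] with x h1 h2 h3 h4
  rw [h4, h3, Pi.sub_apply, Pi.sub_apply, h1, h2]
  exact norm_regLog_mul_sub_le δ.2 _ _

/-- The nondispersive part `u ↦ i λ f_δ(|u|²) u - α₁ u` of the skeleton equation. -/
def forcing (lam α₁ : ℝ) (δ : Ioi (0 : ℝ)) (u : L2 d) : L2 d :=
  (Complex.I * (lam : ℂ)) • regLogMul δ u - (α₁ : ℂ) • u

theorem coeFn_forcing (lam α₁ : ℝ) (δ : Ioi (0 : ℝ)) (u : L2 d) :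
    ∀ᵐ x, forcing lam α₁ δ u x =
      Complex.I * lam * (regLog δ (‖u x‖ ^ 2) * u x) - α₁ * u x := by
  filter_upwards [coeFn_regLogMul δ u, Lp.coeFn_smul (Complex.I * (lam : ℂ)) (regLogMul δ u),
    Lp.coeFn_smul (α₁ : ℂ) u, Lp.coeFn_sub ((Complex.I * (lam : ℂ)) • regLogMul δ u)
      ((α₁ : ℂ) • u)] with x h1 h2 h3 h4
  rw [forcing, h4, Pi.sub_apply, h2, h3, Pi.smul_apply, Pi.smul_apply, h1, smul_eq_mul,
    smul_eq_mul]

theorem continuous_forcing (lam α₁ : ℝ) (δ : Ioi (0 : ℝ)) :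
    Continuous (forcing lam α₁ δ : L2 d → L2 d) := by
  unfold forcing
  exact ((continuous_regLogMul δ).const_smul (Complex.I * (lam : ℂ))).sub
    (continuous_id.const_smul (α₁ : ℂ))

/-- With `α₁ > 2 |λ|` this is a strict dissipativity estimate, uniform in `δ`. -/
theorem inner_forcing_sub_le (lam α₁ : ℝ) (δ : Ioi (0 : ℝ)) (u v : L2 d) :
    inner ℝ (u - v) (forcing lam α₁ δ u - forcing lam α₁ δ v) ≤
      -(α₁ - 2 * |lam|) * ‖u - v‖ ^ 2 := by
  rw [L2.inner_def, norm_sq_eq_integral, ← integral_const_mul]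
  refine integral_mono_ae (L2.integrable_inner _ _) ((integrable_norm_sq _).const_mul _) ?_
  filter_upwards [coeFn_forcing lam α₁ δ u, coeFn_forcing lam α₁ δ v, Lp.coeFn_sub u v,
    Lp.coeFn_sub (forcing lam α₁ δ u) (forcing lam α₁ δ v)] with x h1 h2 h3 h4
  rw [h4, h3, Pi.sub_apply, Pi.sub_apply, h1, h2]
  exact re_inner_regLog_sub_le δ.2 lam α₁ _ _

theorem forcing_phaseMul (lam α₁ : ℝ) (δ : Ioi (0 : ℝ)) {φ : Space d → ℝ} (hφ : Measurable φ)
    (u : L2 d) : forcing lam α₁ δ (phaseMul φ hφ u) = phaseMul φ hφ (forcing lam α₁ δ u) := by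
  apply Lp.ext
  filter_upwards [coeFn_forcing lam α₁ δ (phaseMul φ hφ u), coeFn_forcing lam α₁ δ u,
    coeFn_phaseMul hφ u, coeFn_phaseMul hφ (forcing lam α₁ δ u)] with x h1 h2 h3 h4
  rw [h1, h4, h2, h3, norm_mul, Complex.norm_exp_ofReal_mul_I, one_mul]
  ring

theorem forcing_translate (lam α₁ : ℝ) (δ : Ioi (0 : ℝ)) (a : Space d) (u : L2 d) :
    forcing lam α₁ δ (translate a u) = translate a (forcing lam α₁ δ u) := by
  apply Lp.ext
  filter_upwards [coeFn_forcing lam α₁ δ (translate a u),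
    ae_comp_add_right (coeFn_forcing lam α₁ δ u) a, coeFn_translate a u,
    coeFn_translate a (forcing lam α₁ δ u)] with x h1 h2 h3 h4
  rw [h1, h4, h2, h3]

theorem forcing_neg (lam α₁ : ℝ) (δ : Ioi (0 : ℝ)) (u : L2 d) :
    forcing lam α₁ δ (-u) = -forcing lam α₁ δ u := by
  apply Lp.ext
  filter_upwards [coeFn_forcing lam α₁ δ (-u), coeFn_forcing lam α₁ δ u, Lp.coeFn_neg u,
    Lp.coeFn_neg (forcing lam α₁ δ u)] with x h1 h2 h3 h4
  rw [h1, h4, Pi.neg_apply, h2, h3, Pi.neg_apply, norm_neg]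
  ring

variable {lam α₁ : ℝ} {δ : Ioi (0 : ℝ)} {T : ℝ} {u₀ : X1 d} {g : ℝ → ℝ} {y : ℝ → X1 d}

/-! ### Contraction along the skeleton equation -/

theorem continuous_toL2 : Continuous (X1.toL2 : X1 d → L2 d) := by
  unfold X1.toL2
  fun_prop

/-- The skeleton equation in the interaction picture: after removal of the group, the solution is
the primitive of a continuous function. -/
theorem IsSkeletonSolution.interaction (hy : IsSkeletonSolution lam α₁ δ T u₀ g y)
    (hg : ContinuousOn g (Icc 0 T)) {t : ℝ} (ht : t ∈ Icc 0 T) :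
    schrodinger (-g t) (y t).toL2 = schrodinger (-g 0) u₀.toL2
      + ∫ s in 0..t, schrodinger (-g s) (forcing lam α₁ δ (y s).toL2) := by
  have hsub : uIcc 0 t ⊆ Icc 0 T := by
    rw [uIcc_of_le ht.1]
    exact Icc_subset_Icc_right ht.2
  have hyc : ContinuousOn (fun s => (y s).toL2) (Icc 0 T) :=
    continuous_toL2.comp_continuousOn hy.1
  have h1 : ContinuousOn (fun s => schrodinger (g t - g s)
      ((Complex.I * (lam : ℂ)) • regLogMul δ (y s).toL2)) (Icc 0 T) :=
    continuousOn_schrodinger (continuousOn_const.sub hg)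
      (((continuous_const_smul (Complex.I * (lam : ℂ))).comp
        (continuous_regLogMul δ)).comp_continuousOn hyc)
  have h2 : ContinuousOn (fun s => schrodinger (g t - g s) ((α₁ : ℂ) • (y s).toL2)) (Icc 0 T) :=
    continuousOn_schrodinger (continuousOn_const.sub hg)
      ((continuous_const_smul (α₁ : ℂ)).comp_continuousOn hyc)
  have h3 := hy.2 t ht
  simp only [schrodingerGroup_eq] at h3
  rw [add_sub_assoc, ← intervalIntegral.integral_sub (h1.mono hsub).intervalIntegrable
    (h2.mono hsub).intervalIntegrable] at h3
  simp only [← map_sub] at h3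
  have h4 := (schrodinger (d := d) (-g t)).toContinuousLinearMap.intervalIntegral_comp_comm
    (((h1.sub h2).mono hsub).intervalIntegrable (μ := volume))
  simp only [Pi.sub_apply, ← map_sub] at h4
  rw [h3, map_add, schrodinger_schrodinger]
  refine congrArg₂ (· + ·) (by ring_nf) (h4.symm.trans ?_)
  refine intervalIntegral.integral_congr fun s _ => ?_
  change schrodinger (-g t) (schrodinger (g t - g s) _) = _
  rw [schrodinger_schrodinger, forcing]
  ring_nf

theorem IsSkeletonSolution.initial (hy : IsSkeletonSolution lam α₁ δ T u₀ g y) (hT : 0 ≤ T) :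
    (y 0).toL2 = u₀.toL2 := by
  have h := hy.2 0 (left_mem_Icc.2 hT)
  simpa [schrodingerGroup_eq, schrodinger_zero] using h

/-- Exponential decay of `‖U y - y‖` along a solution `y`, for a family of symmetries `U t` of the
nonlinearity which the group transports into one another. -/
theorem IsSkeletonSolution.norm_symmetry_sub_le (hy : IsSkeletonSolution lam α₁ δ T u₀ g y)
    (hg : ContinuousOn g (Icc 0 T)) (hT : 0 < T) (U : ℝ → L2 d →L[ℂ] L2 d) (U₀ : L2 d →L[ℂ] L2 d)
    (hS : ∀ t u, U t (schrodinger (g t) u) = schrodinger (g t) (U₀ u))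
    (hN : ∀ t u, U t (forcing lam α₁ δ u) = forcing lam α₁ δ (U t u)) :
    ‖U T (y T).toL2 - (y T).toL2‖ ≤
      Real.exp (-(α₁ - 2 * |lam|) * T) * ‖U 0 u₀.toL2 - u₀.toL2‖ := by
  set κ := α₁ - 2 * |lam| with hκ
  set p : ℝ → L2 d := fun t => schrodinger (-g t) (y t).toL2 with hp
  set F : ℝ → L2 d := fun t => schrodinger (-g t) (forcing lam α₁ δ (y t).toL2) with hF
  set D : L2 d →L[ℂ] L2 d := U₀ - ContinuousLinearMap.id ℂ _ with hD
  have hyc : ContinuousOn (fun s => (y s).toL2) (Icc 0 T) :=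
    continuous_toL2.comp_continuousOn hy.1
  have hpc : ContinuousOn p (Icc 0 T) := continuousOn_schrodinger hg.neg hyc
  have hFc : ContinuousOn F (Icc 0 T) :=
    continuousOn_schrodinger hg.neg ((continuous_forcing lam α₁ δ).comp_continuousOn hyc)
  have hSS : ∀ t u, schrodinger (g t) (schrodinger (-g t) u) = u := fun t (u : L2 d) => by
    rw [schrodinger_schrodinger, add_neg_cancel, schrodinger_zero]
  -- the symmetries in the interaction picture
  have hDp : ∀ t u, schrodinger (g t) (D (schrodinger (-g t) u)) = U t u - u := fun t u => by
    rw [hD, sub_apply, ContinuousLinearMap.id_apply, map_sub, ← hS, hSS]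
  have hderiv : ∀ t ∈ Ioo 0 T, HasDerivAt p (F t) t := by
    intro t ht
    have hFt : ContinuousAt F t := hFc.continuousAt (Icc_mem_nhds ht.1 ht.2)
    have h1 : HasDerivAt (fun t => schrodinger (-g 0) u₀.toL2 + ∫ s in 0..t, F s) (F t) t := by
      refine (intervalIntegral.integral_hasDerivAt_right ?_ ?_ hFt).const_add _
      · refine (hFc.mono ?_).intervalIntegrable
        rw [uIcc_of_le ht.1.le]
        exact Icc_subset_Icc_right ht.2.le
      · exact (hFc.mono Ioo_subset_Icc_self).stronglyMeasurableAtFilter isOpen_Ioo t ht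
    refine h1.congr_of_eventuallyEq ?_
    filter_upwards [Icc_mem_nhds ht.1 ht.2] with s hs
    exact hy.interaction hg hs
  have hanti : AntitoneOn (fun t => Real.exp (2 * κ * t) * ‖D (p t)‖ ^ 2) (Icc 0 T) := by
    have hder : ∀ t ∈ Ioo 0 T, HasDerivAt (fun t => Real.exp (2 * κ * t) * ‖D (p t)‖ ^ 2)
        (Real.exp (2 * κ * t) * (2 * κ) * ‖D (p t)‖ ^ 2
          + Real.exp (2 * κ * t) * (2 * inner ℝ (D (p t)) (D (F t)))) t := by
      intro t ht
      have h1 : HasDerivAt (fun t => Real.exp (2 * κ * t)) (Real.exp (2 * κ * t) * (2 * κ)) t := by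
        simpa using ((hasDerivAt_id t).const_mul (2 * κ)).exp
      have h2 : HasDerivAt (fun t => D (p t)) (D (F t)) t :=
        (D.restrictScalars ℝ).hasFDerivAt.comp_hasDerivAt t (hderiv t ht)
      exact h1.mul h2.norm_sq
    refine antitoneOn_of_deriv_nonpos (convex_Icc 0 T) ?_ ?_ ?_
    · have := D.continuous.comp_continuousOn hpc
      exact (by fun_prop : Continuous fun t => Real.exp (2 * κ * t)).continuousOn.mul
        (this.norm.pow 2)
    · intro t ht
      rw [interior_Icc] at ht
      exact (hder t ht).differentiableAt.differentiableWithinAt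
    · intro t ht
      rw [interior_Icc] at ht
      rw [(hder t ht).deriv]
      have h1 := inner_forcing_sub_le lam α₁ δ (U t (y t).toL2) (y t).toL2
      -- the group preserves inner products, so only the dissipative part contributes
      have h2 : inner ℝ (D (p t)) (D (F t)) ≤ -κ * ‖D (p t)‖ ^ 2 := by
        rw [← hN, ← hDp, ← hDp, LinearIsometry.norm_map] at h1
        let V : L2 d →ₗᵢ[ℝ] L2 d :=
          ⟨(schrodinger (g t)).toLinearMap.restrictScalars ℝ, (schrodinger (g t)).norm_map⟩
        have h3 := V.inner_map_map (D (p t)) (D (F t))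
        exact h3.symm.trans_le h1
      nlinarith [Real.exp_pos (2 * κ * t)]
  have hfin := hanti (left_mem_Icc.2 hT.le) (right_mem_Icc.2 hT.le) hT.le
  have hnorm : ∀ t, ‖D (p t)‖ = ‖U t (y t).toL2 - (y t).toL2‖ := fun t => by
    rw [← hDp, LinearIsometry.norm_map]
  simp only [hnorm, hy.initial hT.le, mul_zero, Real.exp_zero, one_mul] at hfin
  have he : Real.exp (-κ * T) * Real.exp (κ * T) = 1 := by
    rw [← Real.exp_add, neg_mul, neg_add_cancel, Real.exp_zero]
  have he2 : Real.exp (2 * κ * T) = Real.exp (κ * T) ^ 2 := by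
    rw [← Real.exp_nat_mul]
    congr 1
    push_cast
    ring
  rw [he2, ← mul_pow] at hfin
  have h := (pow_le_pow_iff_left₀ (by positivity) (norm_nonneg _) two_ne_zero).1 hfin
  calc ‖U T (y T).toL2 - (y T).toL2‖
      = Real.exp (-κ * T) * (Real.exp (κ * T) * ‖U T (y T).toL2 - (y T).toL2‖) := by
        rw [← mul_assoc, he, one_mul]
    _ ≤ _ := mul_le_mul_of_nonneg_left h (Real.exp_pos _).le

/-! ### Difference quotients -/

theorem norm_phaseMul_sub_le {φ : Space d → ℝ} (hφ : Measurable φ) {u w : L2 d} {K : ℝ}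
    (h : ∀ᵐ x, |φ x| * ‖u x‖ ≤ K * ‖w x‖) : ‖phaseMul φ hφ u - u‖ ≤ K * ‖w‖ := by
  apply Lp.norm_le_mul_norm_of_ae_le_mul
  filter_upwards [h, coeFn_phaseMul hφ u, Lp.coeFn_sub (phaseMul φ hφ u) u] with x h1 h2 h3
  rw [h3, Pi.sub_apply, h2, ← sub_one_mul, norm_mul, mul_comm (φ x : ℂ)]
  exact (mul_le_mul_of_nonneg_right Real.norm_exp_I_mul_ofReal_sub_one_le (norm_nonneg _)).trans h1

theorem tendsto_phase_quotient (θ : ℝ) :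
    Tendsto (fun h : ℝ => (h : ℂ)⁻¹ * (Complex.exp (((h * θ : ℝ) : ℂ) * Complex.I) - 1)) (𝓝[>] 0)
      (𝓝 (θ * Complex.I)) := by
  have h1 : HasDerivAt (fun h : ℝ => Complex.exp (((h * θ : ℝ) : ℂ) * Complex.I))
      (θ * Complex.I) 0 := by
    have h2 : HasDerivAt (fun h : ℝ => ((h * θ : ℝ) : ℂ) * Complex.I) (θ * Complex.I) 0 := by
      simpa using (((hasDerivAt_id (0 : ℝ)).mul_const θ).ofReal_comp).mul_const Complex.I
    simpa using h2.cexp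
  refine ((hasDerivAt_iff_tendsto_slope_zero.1 h1).mono_left
    (nhdsWithin_mono _ fun h hh => (mem_Ioi.1 hh).ne')).congr fun h => ?_
  simp [Complex.real_smul]

/-- Multiplication by `φ` is bounded by the difference quotients of the multiplications by
`exp (i h φ)`, by Fatou's lemma. -/
theorem norm_le_of_norm_phaseMul_sub_le {φ : Space d → ℝ} (hφ : Measurable φ) {u w : L2 d}
    (hw : ∀ᵐ x, ‖w x‖ = |φ x| * ‖u x‖) {C C' : ℝ}
    (hC : ∀ h : ℝ, 0 < h → ‖phaseMul (fun x => h * φ x) (hφ.const_mul h) u - u‖ ≤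
      h * C + h ^ 2 * C') : ‖w‖ ≤ C := by
  set f : ℝ → Space d → ℂ := fun h x =>
    (h : ℂ)⁻¹ * (Complex.exp (((h * φ x : ℝ) : ℂ) * Complex.I) - 1) * u x with hf
  have hfm : ∀ h, AEStronglyMeasurable (f h) volume := fun h => by
    have h1 : Measurable fun x => (h : ℂ)⁻¹ *
        (Complex.exp (((h * φ x : ℝ) : ℂ) * Complex.I) - 1) := by fun_prop
    exact h1.aestronglyMeasurable.mul (Lp.aestronglyMeasurable u)
  have hfn : ∀ h, 0 < h → eLpNorm (f h) 2 volume ≤ ENNReal.ofReal (C + h * C') := by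
    intro h hh
    set v : L2 d := (h : ℂ)⁻¹ • (phaseMul (fun x => h * φ x) (hφ.const_mul h) u - u) with hv
    have h1 : f h =ᵐ[volume] v := by
      filter_upwards [coeFn_phaseMul (hφ.const_mul h) u,
        Lp.coeFn_sub (phaseMul (fun x => h * φ x) (hφ.const_mul h) u) u,
        Lp.coeFn_smul (h : ℂ)⁻¹ (phaseMul (fun x => h * φ x) (hφ.const_mul h) u - u)]
        with x h1 h2 h3
      rw [hf, h3, Pi.smul_apply, h2, Pi.sub_apply, h1, smul_eq_mul]
      ring
    have h2 : ‖v‖ ≤ C + h * C' := by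
      rw [hv, norm_smul, norm_inv, Complex.norm_real, Real.norm_of_nonneg hh.le]
      calc h⁻¹ * _ ≤ h⁻¹ * (h * C + h ^ 2 * C') :=
            mul_le_mul_of_nonneg_left (hC h hh) (inv_pos.2 hh).le
        _ = C + h * C' := by field_simp
    rw [eLpNorm_congr_ae h1, ← ENNReal.ofReal_toReal (Lp.eLpNorm_ne_top v), ← Lp.norm_def]
    exact ENNReal.ofReal_le_ofReal h2
  have hlim : ∀ᵐ x, Tendsto (f · x) (𝓝[>] 0) (𝓝 (φ x * Complex.I * u x)) :=
    ae_of_all _ fun x => (tendsto_phase_quotient (φ x)).mul_const (u x)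
  have hnorm : eLpNorm (fun x => φ x * Complex.I * u x) 2 volume = eLpNorm w 2 volume := by
    refine eLpNorm_congr_norm_ae ?_
    filter_upwards [hw] with x hx
    rw [hx, norm_mul, norm_mul, Complex.norm_I, Complex.norm_real, Real.norm_eq_abs, mul_one]
  have hclim : Tendsto (fun h => C + h * C') (𝓝[>] 0) (𝓝 C) := by
    have h1 : Continuous fun h => C + h * C' := by fun_prop
    simpa using (h1.tendsto 0).mono_left nhdsWithin_le_nhds
  have hC0 : 0 ≤ C := by
    refine ge_of_tendsto hclim ?_
    filter_upwards [self_mem_nhdsWithin] with h hh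
    exact nonneg_of_mul_nonneg_right
      (((norm_nonneg _).trans (hC h hh)).trans_eq (by ring : _ = h * (C + h * C'))) hh
  refine le_of_forall_pos_le_add fun η hη => ?_
  have h1 : eLpNorm w 2 volume ≤ ENNReal.ofReal (C + η) := by
    rw [← hnorm]
    refine Lp.eLpNorm_le_of_ae_tendsto ?_ hfm hlim
    filter_upwards [self_mem_nhdsWithin, hclim.eventually_le_const (lt_add_of_pos_right C hη)]
      with h hh hle
    exact (hfn h hh).trans (ENNReal.ofReal_le_ofReal hle)
  rw [Lp.norm_def]
  exact ENNReal.toReal_le_of_le_ofReal (by positivity) h1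

/-- The `j`-th vector of the standard basis. -/
abbrev basisVec (j : Fin d) : Space d := EuclideanSpace.single j (1 : ℝ)

theorem wave_smul (h : ℝ) (b : Space d) : wave (h • b) = fun x => h * wave b x := by
  ext x
  simp only [wave, inner_smul_right]
  ring

/-- The Fourier transform turns a weak partial derivative into multiplication by `2π i ξⱼ`. -/
theorem IsWeakDeriv.fourier {j : Fin d} {u v : L2 d} (h : IsWeakDeriv j u v) :
    ∀ᵐ ξ, (𝓕 v : L2 d) ξ = wave (basisVec j) ξ * Complex.I * (𝓕 u : L2 d) ξ := by
  have h1 : 𝓕 (v : 𝓢'(Space d, ℂ)) = (2 * Real.pi * Complex.I) •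
      TemperedDistribution.smulLeftCLM ℂ (inner ℝ · (basisVec j)) (𝓕 (u : 𝓢'(Space d, ℂ))) := by
    rw [← TemperedDistribution.fourier_lineDerivOp_eq, ← h]
  rw [Lp.fourier_toTemperedDistribution_eq, Lp.fourier_toTemperedDistribution_eq] at h1
  have hloc : ∀ f : L2 d, LocallyIntegrable f volume := fun f =>
    (Lp.memLp f).locallyIntegrable (by norm_num)
  -- `ξⱼ 𝓕u` is not yet known to be in `L²`, so the two sides are compared as locally integrable
  -- functions
  have hloc2 : LocallyIntegrable
      (fun ξ => ((wave (basisVec j) ξ : ℂ) * Complex.I) • (𝓕 u : L2 d) ξ) volume :=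
    (hloc (𝓕 u)).continuous_smul (by unfold wave; fun_prop)
  refine ae_eq_of_integral_contDiff_smul_eq (hloc _) hloc2 fun q hq hqc => ?_
  have hg₁ : HasCompactSupport (Complex.ofRealCLM ∘ q) := hqc.comp_left rfl
  have hg₂ := Complex.ofRealCLM.contDiff.comp hq
  set ψ : 𝓢(Space d, ℂ) := hg₁.toSchwartzMap hg₂ with hψ
  have htg : (fun x : Space d => ((inner ℝ x (basisVec j) : ℝ) : ℂ)).HasTemperateGrowth := by
    fun_prop
  have h2 : Lp.toTemperedDistribution (𝓕 v : L2 d) ψ = (2 * Real.pi * Complex.I) •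
      Lp.toTemperedDistribution (𝓕 u : L2 d) (SchwartzMap.smulLeftCLM ℂ
        (fun x : Space d => ((inner ℝ x (basisVec j) : ℝ) : ℂ)) ψ) := DFunLike.congr_fun h1 ψ
  rw [Lp.toTemperedDistribution_apply, Lp.toTemperedDistribution_apply, ← integral_smul] at h2
  refine Eq.trans (integral_congr_ae (ae_of_all _ fun x => ?_))
    (h2.trans (integral_congr_ae (ae_of_all _ fun x => ?_)))
  · simp [hψ]
  · simp [hψ, htg, wave]
    ring

theorem IsWeakDeriv.norm_fourier {j : Fin d} {u v : L2 d} (h : IsWeakDeriv j u v) :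
    ∀ᵐ ξ, ‖(𝓕 v : L2 d) ξ‖ = |wave (basisVec j) ξ| * ‖(𝓕 u : L2 d) ξ‖ := by
  filter_upwards [h.fourier] with ξ hξ
  rw [hξ, norm_mul, norm_mul, Complex.norm_I, Complex.norm_real, Real.norm_eq_abs, mul_one]

theorem norm_translate_sub (a : Space d) (u : L2 d) :
    ‖translate a u - u‖ = ‖modulate a (𝓕 u) - 𝓕 u‖ := by
  rw [← fourier_translate, ← Lp.norm_fourier_eq]
  exact congrArg norm ((Lp.fourierTransformₗᵢ (Space d) ℂ).map_sub _ _)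

theorem modulate_smul (h : ℝ) (b : Space d) (u : L2 d) :
    modulate (h • b) u = phaseMul (fun x => h * wave b x) ((measurable_wave b).const_mul h) u :=
  phaseMul_congr _ _ (wave_smul h b) u

/-- Translations differ from the identity by at most their length times the weak derivative. -/
theorem IsWeakDeriv.norm_translate_sub_le {j : Fin d} {u v : L2 d} (h : IsWeakDeriv j u v)
    (a : ℝ) : ‖translate (a • basisVec j) u - u‖ ≤ |a| * ‖v‖ := by
  rw [norm_translate_sub, modulate_smul, ← Lp.norm_fourier_eq v]
  apply norm_phaseMul_sub_le
  filter_upwards [h.norm_fourier] with x hx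
  rw [hx, abs_mul, mul_assoc]

/-- The converse of `IsWeakDeriv.norm_translate_sub_le`: a bound on the difference quotients of
`u` bounds its weak derivative. -/
theorem IsWeakDeriv.norm_le {j : Fin d} {u v : L2 d} (h : IsWeakDeriv j u v) {C : ℝ}
    (hC : ∀ a : ℝ, 0 < a → ‖translate (a • basisVec j) u - u‖ ≤ a * C) : ‖v‖ ≤ C := by
  rw [← Lp.norm_fourier_eq v]
  refine norm_le_of_norm_phaseMul_sub_le (C' := 0) (measurable_wave _) h.norm_fourier
    fun a ha => ?_
  rw [← modulate_smul, ← norm_translate_sub, mul_zero, add_zero]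
  exact hC a ha

/-! ### The norm of `X₁` -/

theorem X1.norm_toL2_le (u : X1 d) : ‖u.toL2‖ ≤ ‖u‖ := by
  refine le_of_sq_le_sq ?_ (norm_nonneg _)
  have : 0 ≤ ∑ j, ‖u.deriv j‖ ^ 2 := by positivity
  nlinarith [u.norm_sq, sq_nonneg ‖u.weighted‖]

theorem X1.norm_deriv_le (u : X1 d) (j : Fin d) : ‖u.deriv j‖ ≤ ‖u‖ := by
  refine le_of_sq_le_sq ?_ (norm_nonneg _)
  have := Finset.single_le_sum (f := fun j => ‖u.deriv j‖ ^ 2) (fun j _ => sq_nonneg _)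
    (Finset.mem_univ j)
  nlinarith [u.norm_sq, sq_nonneg ‖u.weighted‖, sq_nonneg ‖u.toL2‖]

theorem X1.norm_weighted_le (u : X1 d) : ‖u.weighted‖ ≤ ‖u‖ := by
  refine le_of_sq_le_sq ?_ (norm_nonneg _)
  have : 0 ≤ ∑ j, ‖u.deriv j‖ ^ 2 := by positivity
  nlinarith [u.norm_sq, sq_nonneg ‖u.toL2‖]

theorem wave_basisVec (j : Fin d) (x : Space d) : wave (basisVec j) x = 2 * Real.pi * x j := by
  simp [wave, basisVec, EuclideanSpace.inner_single_right]

theorem X1.norm_wave_mul_le (u : X1 d) (j : Fin d) :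
    ∀ᵐ x, |wave (basisVec j) x| * ‖u.toL2 x‖ ≤ 2 * Real.pi * ‖u.weighted x‖ := by
  filter_upwards [u.2.2] with x hx
  change u.weighted x = _ * u.toL2 x at hx
  rw [hx, norm_mul, Complex.norm_real, Real.norm_of_nonneg (Real.sqrt_nonneg _), wave_basisVec,
    abs_mul, abs_of_pos Real.two_pi_pos, mul_assoc]
  have h1 : |x j| ≤ Real.sqrt (1 + ‖x‖ ^ 2) := by
    refine Real.le_sqrt_of_sq_le ?_
    rw [sq_abs]
    have := sq_le_sq' (by linarith [norm_nonneg (x j), norm_nonneg x]) (PiLp.norm_apply_le x j)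
    rw [Real.norm_eq_abs, sq_abs] at this
    linarith
  gcongr

/-- The function `2π xⱼ u` in `L²`, for `u ∈ X₁`. -/
def X1.waveMul (u : X1 d) (j : Fin d) : L2 d :=
  MemLp.toLp (fun x => (wave (basisVec j) x : ℂ) * u.toL2 x) <| by
    refine (Lp.memLp u.weighted).of_le_mul (c := 2 * Real.pi) ?_ ?_
    · have h : Measurable fun x : Space d => (wave (basisVec j) x : ℂ) := by fun_prop
      exact h.aestronglyMeasurable.mul (Lp.aestronglyMeasurable _)
    · filter_upwards [u.norm_wave_mul_le j] with x hx
      rwa [norm_mul, Complex.norm_real, Real.norm_eq_abs]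

theorem X1.norm_waveMul (u : X1 d) (j : Fin d) :
    ∀ᵐ x, ‖u.waveMul j x‖ = |wave (basisVec j) x| * ‖u.toL2 x‖ := by
  have h : u.waveMul j =ᵐ[volume] fun x => (wave (basisVec j) x : ℂ) * u.toL2 x :=
    MemLp.coeFn_toLp _
  filter_upwards [h] with x hx
  rw [hx, norm_mul, Complex.norm_real, Real.norm_eq_abs]

theorem X1.norm_waveMul_le (u : X1 d) (j : Fin d) :
    ‖u.waveMul j‖ ≤ 2 * Real.pi * ‖u.weighted‖ := by
  apply Lp.norm_le_mul_norm_of_ae_le_mul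
  filter_upwards [u.norm_waveMul j, u.norm_wave_mul_le j] with x h1 h2
  rwa [h1]

theorem X1.norm_weighted_sq_le (u : X1 d) :
    ‖u.weighted‖ ^ 2 ≤ ‖u.toL2‖ ^ 2 + ∑ j, ‖u.waveMul j‖ ^ 2 := by
  simp only [norm_sq_eq_integral]
  rw [← integral_finsetSum _ fun j _ => integrable_norm_sq _,
    ← integral_add (integrable_norm_sq _) (integrable_finsetSum _ fun j _ => integrable_norm_sq _)]
  refine integral_mono_ae (integrable_norm_sq _) ((integrable_norm_sq _).add
    (integrable_finsetSum _ fun j _ => integrable_norm_sq _)) ?_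
  filter_upwards [u.2.2, ae_all_iff.2 u.norm_waveMul] with x hx hw
  change u.weighted x = _ * u.toL2 x at hx
  simp only [hw]
  rw [hx, norm_mul, Complex.norm_real, Real.norm_of_nonneg (Real.sqrt_nonneg _), mul_pow,
    Real.sq_sqrt (by positivity), EuclideanSpace.norm_sq_eq, one_add_mul, Finset.sum_mul]
  refine add_le_add le_rfl (Finset.sum_le_sum fun j _ => ?_)
  rw [mul_pow, wave_basisVec, sq_abs, mul_pow, Real.norm_eq_abs, sq_abs]
  have h1 : 1 ≤ (2 * Real.pi) ^ 2 := by nlinarith [Real.pi_gt_three]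
  nlinarith [sq_nonneg (x j), mul_nonneg (sq_nonneg (x j)) (sq_nonneg ‖u.toL2 x‖)]

/-! ### A priori bounds in `X₁` -/

/-- Decay of mass: the symmetry here is `u ↦ -u`. -/
theorem IsSkeletonSolution.norm_toL2_le (hy : IsSkeletonSolution lam α₁ δ T u₀ g y)
    (hg : ContinuousOn g (Icc 0 T)) (hT : 0 < T) :
    ‖(y T).toL2‖ ≤ Real.exp (-(α₁ - 2 * |lam|) * T) * ‖u₀.toL2‖ := by
  have h := hy.norm_symmetry_sub_le hg hT (fun _ => -ContinuousLinearMap.id ℂ _)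
    (-ContinuousLinearMap.id ℂ _) (fun t u => by simp)
    (fun t u => by simp [forcing_neg])
  have h2 : ∀ u : L2 d, ‖-u - u‖ = 2 * ‖u‖ := fun u => by
    rw [← neg_add', norm_neg, ← two_smul ℝ u, norm_smul]
    norm_num
  simp only [neg_apply, ContinuousLinearMap.id_apply, h2] at h
  linarith

/-- Decay of the gradient: the symmetries are the translations, which commute with the group and
with the nonlinearity. -/
theorem IsSkeletonSolution.norm_deriv_le (hy : IsSkeletonSolution lam α₁ δ T u₀ g y)
    (hg : ContinuousOn g (Icc 0 T)) (hT : 0 < T) (j : Fin d) :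
    ‖(y T).deriv j‖ ≤ Real.exp (-(α₁ - 2 * |lam|) * T) * ‖u₀.deriv j‖ := by
  refine IsWeakDeriv.norm_le ((y T).2.1 j) fun a ha => ?_
  have h := hy.norm_symmetry_sub_le hg hT
    (fun _ => (translate (a • basisVec j)).toContinuousLinearMap)
    (translate (a • basisVec j)).toContinuousLinearMap
    (fun t u => (schrodinger_translate _ _ _).symm)
    (fun t u => (forcing_translate _ _ _ _ _).symm)
  have h2 := IsWeakDeriv.norm_translate_sub_le (u₀.2.1 j) a
  rw [abs_of_pos ha] at h2
  refine h.trans ((mul_le_mul_of_nonneg_left h2 (Real.exp_pos _).le).trans_eq ?_)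
  rw [X1.deriv]
  ring

/-- Growth of the weight along a solution: a modulation of the initial datum is transported by the
group into a modulation and a translation by `-4π g(t) b`, whose size is controlled by the
gradient. -/
theorem IsSkeletonSolution.norm_waveMul_le (hy : IsSkeletonSolution lam α₁ δ T u₀ g y)
    (hg : ContinuousOn g (Icc 0 T)) (hg0 : g 0 = 0) (hT : 0 < T) (j : Fin d) :
    ‖(y T).waveMul j‖ ≤ Real.exp (-(α₁ - 2 * |lam|) * T) * ‖u₀.waveMul j‖
      + 4 * Real.pi * |g T| * ‖(y T).deriv j‖ := by
  refine norm_le_of_norm_phaseMul_sub_le (C' := 4 * Real.pi ^ 2 * |g T| * ‖(y T).toL2‖)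
    (measurable_wave _) ((y T).norm_waveMul j) fun h hh => ?_
  rw [← modulate_smul]
  set b : Space d := h • basisVec j with hb
  have hnb : ‖b‖ = h := by
    rw [hb, norm_smul, PiLp.norm_single, norm_one, mul_one, Real.norm_of_nonneg hh.le]
  -- `U t = exp(i g(t) Δ) ∘ modulate b ∘ exp(-i g(t) Δ)`, in the form of `schrodinger_modulate`
  let P : ℝ → L2 d →ₗᵢ[ℂ] L2 d := fun t =>
    phaseMul (fun _ => -(4 * Real.pi ^ 2 * g t * ‖b‖ ^ 2)) measurable_const
  let U : ℝ → L2 d →ₗᵢ[ℂ] L2 d := fun t =>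
    (P t).comp ((modulate b).comp (translate (-(4 * Real.pi * g t) • b)))
  have hU : ∀ t u, U t u = P t (modulate b (translate (-(4 * Real.pi * g t) • b) u)) :=
    fun _ _ => rfl
  have hS : ∀ t u, U t (schrodinger (g t) u) = schrodinger (g t) (modulate b u) :=
    fun t u => (schrodinger_modulate (g t) b u).symm
  have h1 := hy.norm_symmetry_sub_le hg hT (fun t => (U t).toContinuousLinearMap)
    (modulate b).toContinuousLinearMap hS (fun t u => by
      change U t _ = forcing lam α₁ δ (U t u)
      rw [hU, hU, forcing_phaseMul, forcing_phaseMul, forcing_translate])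
  have h0 : U 0 u₀.toL2 = modulate b u₀.toL2 := by
    have := hS 0 u₀.toL2
    rwa [hg0, schrodinger_zero, schrodinger_zero] at this
  change ‖U T (y T).toL2 - _‖ ≤ _ * ‖U 0 u₀.toL2 - _‖ at h1
  rw [h0] at h1
  have h2 : ‖modulate b u₀.toL2 - u₀.toL2‖ ≤ h * ‖u₀.waveMul j‖ := by
    rw [hb, modulate_smul]
    apply norm_phaseMul_sub_le
    filter_upwards [u₀.norm_waveMul j] with x hx
    rw [hx, abs_mul, abs_of_pos hh, mul_assoc]
  set v := translate (-(4 * Real.pi * g T) • b) (y T).toL2 with hv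
  have h3 : ‖P T (modulate b v) - modulate b v‖ ≤
      4 * Real.pi ^ 2 * |g T| * h ^ 2 * ‖(y T).toL2‖ := by
    have : ‖modulate b v‖ = ‖(y T).toL2‖ := by rw [hv, LinearIsometry.norm_map,
      LinearIsometry.norm_map]
    rw [← this]
    refine norm_phaseMul_sub_le _ (ae_of_all _ fun x => le_of_eq ?_)
    rw [abs_neg, abs_mul, abs_mul, abs_mul, abs_of_pos (by norm_num : (0 : ℝ) < 4), abs_pow,
      abs_of_pos Real.pi_pos, hnb, abs_of_nonneg (sq_nonneg h)]
  have h4 : ‖v - (y T).toL2‖ ≤ 4 * Real.pi * |g T| * h * ‖(y T).deriv j‖ := by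
    have := IsWeakDeriv.norm_translate_sub_le ((y T).2.1 j) (-(4 * Real.pi * g T) * h)
    rw [mul_smul, ← hb, abs_mul, abs_neg, abs_mul, abs_of_pos hh,
      abs_of_pos (by positivity : 0 < 4 * Real.pi)] at this
    exact this
  have h5 : modulate b (y T).toL2 - (y T).toL2 = (U T (y T).toL2 - (y T).toL2)
      - (P T (modulate b v) - modulate b v) - modulate b (v - (y T).toL2) := by
    rw [hU, map_sub]
    abel
  have h6 := (norm_sub_le (U T (y T).toL2 - (y T).toL2 - (P T (modulate b v) - modulate b v))
    (modulate b (v - (y T).toL2))).trans (add_le_add_left (norm_sub_le _ _) _)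
  rw [← h5, LinearIsometry.norm_map] at h6
  have h7 := mul_le_mul_of_nonneg_left h2 (Real.exp_pos (-(α₁ - 2 * |lam|) * T)).le
  linarith

theorem IsControl.intervalIntegrable {h : ℝ → ℝ} (hc : IsControl T g h) (hT : 0 ≤ T) :
    IntervalIntegrable h volume 0 T := by
  rw [intervalIntegrable_iff_integrableOn_Icc_of_le hT]
  exact hc.1.integrable one_le_two

theorem IsControl.continuousOn {h : ℝ → ℝ} (hc : IsControl T g h) (hT : 0 ≤ T) :
    ContinuousOn g (Icc 0 T) := by
  have h1 := intervalIntegral.continuousOn_primitive_interval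
    ((intervalIntegrable_iff' (μ := volume)).1 (hc.intervalIntegrable hT))
  rw [uIcc_of_le hT] at h1
  exact h1.congr hc.2

theorem IsControl.apply_zero {h : ℝ → ℝ} (hc : IsControl T g h) (hT : 0 ≤ T) : g 0 = 0 := by
  rw [hc.2 0 (left_mem_Icc.2 hT), intervalIntegral.integral_same]

/-- A crude bound, linear in the time horizon; the exponential decay of the gradient absorbs it. -/
theorem IsControl.abs_le {h : ℝ → ℝ} (hc : IsControl T g h) (hT : 0 ≤ T) :
    |g T| ≤ T + ∫ t in 0..T, |h t| ^ 2 := by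
  have h2 : IntervalIntegrable (fun t => |h t| ^ 2) volume 0 T := by
    rw [intervalIntegrable_iff_integrableOn_Icc_of_le hT]
    exact (memLp_two_iff_integrable_sq_norm hc.1.1).1 hc.1
  rw [hc.2 T (right_mem_Icc.2 hT)]
  calc |∫ t in 0..T, h t| ≤ ∫ t in 0..T, |h t| :=
        intervalIntegral.abs_integral_le_integral_abs hT
    _ ≤ ∫ t in 0..T, (1 + |h t| ^ 2) := by
        refine intervalIntegral.integral_mono_on hT (hc.intervalIntegrable hT).abs
          (intervalIntegrable_const.add h2) fun t _ => ?_
        nlinarith [sq_nonneg (|h t| - 1)]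
    _ = T + ∫ t in 0..T, |h t| ^ 2 := by
        rw [intervalIntegral.integral_add intervalIntegrable_const h2,
          intervalIntegral.integral_const]
        simp

/-- A solution with control of energy at most `2` stays in a ball of `X₁` proportional to the
initial datum, uniformly in `δ` and in the time horizon. -/
theorem IsSkeletonSolution.norm_sq_le (hα₁ : 2 * |lam| < α₁)
    (hy : IsSkeletonSolution lam α₁ δ T u₀ g y) {h : ℝ → ℝ} (hc : IsControl T g h) (hT : 0 < T)
    (hE : ∫ t in 0..T, |h t| ^ 2 ≤ 2) :
    ‖y T‖ ^ 2 ≤ (2 + d + d * (2 * Real.pi + 4 * Real.pi * (1 / (α₁ - 2 * |lam|) + 2)) ^ 2)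
      * ‖u₀‖ ^ 2 := by
  set κ := α₁ - 2 * |lam| with hκ
  have hκ0 : 0 < κ := by linarith
  have hg := hc.continuousOn hT.le
  set e := Real.exp (-κ * T) with he
  have he0 : 0 < e := Real.exp_pos _
  have he1 : e ≤ 1 := Real.exp_le_one_iff.2 (by nlinarith)
  have hTe : T * e ≤ 1 / κ := by
    have h1 : κ * T * e ≤ 1 := by
      have h2 : κ * T ≤ Real.exp (κ * T) := by linarith [Real.add_one_le_exp (κ * T)]
      calc κ * T * e ≤ Real.exp (κ * T) * e := by gcongr
        _ = 1 := by rw [he, ← Real.exp_add, neg_mul, add_neg_cancel, Real.exp_zero]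
    rw [le_div_iff₀ hκ0]
    linarith
  have hge : |g T| * e ≤ 1 / κ + 2 := by
    have h1 : |g T| ≤ T + 2 := (hc.abs_le hT.le).trans (by linarith)
    calc |g T| * e ≤ (T + 2) * e := by gcongr
      _ ≤ 1 / κ + 2 := by nlinarith
  have hL : ‖(y T).toL2‖ ≤ ‖u₀‖ := (hy.norm_toL2_le hg hT).trans
    ((mul_le_of_le_one_left (norm_nonneg _) he1).trans u₀.norm_toL2_le)
  have hD : ∀ j, ‖(y T).deriv j‖ ≤ e * ‖u₀‖ := fun j => (hy.norm_deriv_le hg hT j).trans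
    (mul_le_mul_of_nonneg_left (u₀.norm_deriv_le j) he0.le)
  have hD1 : ∀ j, ‖(y T).deriv j‖ ≤ ‖u₀‖ := fun j =>
    (hD j).trans (mul_le_of_le_one_left (norm_nonneg _) he1)
  set K := 2 * Real.pi + 4 * Real.pi * (1 / κ + 2) with hK
  have hW : ∀ j, ‖(y T).waveMul j‖ ≤ K * ‖u₀‖ := by
    intro j
    have h1 : e * ‖u₀.waveMul j‖ ≤ 2 * Real.pi * ‖u₀‖ :=
      (mul_le_of_le_one_left (norm_nonneg _) he1).trans ((u₀.norm_waveMul_le j).trans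
        (mul_le_mul_of_nonneg_left u₀.norm_weighted_le Real.two_pi_pos.le))
    have h2 : 4 * Real.pi * |g T| * ‖(y T).deriv j‖ ≤ 4 * Real.pi * (1 / κ + 2) * ‖u₀‖ :=
      calc 4 * Real.pi * |g T| * ‖(y T).deriv j‖ ≤ 4 * Real.pi * |g T| * (e * ‖u₀‖) := by
            gcongr
            exact hD j
        _ = 4 * Real.pi * (|g T| * e) * ‖u₀‖ := by ring
        _ ≤ _ := by gcongr
    have h3 := hy.norm_waveMul_le hg (hc.apply_zero hT.le) hT j
    rw [hK, add_mul]
    linarith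
  have hDs : ∑ j, ‖(y T).deriv j‖ ^ 2 ≤ d * ‖u₀‖ ^ 2 := by
    refine (Finset.sum_le_sum fun j _ => pow_le_pow_left₀ (norm_nonneg _) (hD1 j) 2).trans_eq ?_
    simp
  have hWs : ∑ j, ‖(y T).waveMul j‖ ^ 2 ≤ d * (K * ‖u₀‖) ^ 2 := by
    refine (Finset.sum_le_sum fun j _ => pow_le_pow_left₀ (norm_nonneg _) (hW j) 2).trans_eq ?_
    simp
  have hLs := pow_le_pow_left₀ (norm_nonneg _) hL 2
  have hsq := (y T).norm_sq
  have hw := (y T).norm_weighted_sq_le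
  nlinarith

/-! ### Exit costs -/

/-- Outside the shrunk set the norm is at least `R - ρ`, since the boundary of an open set lies
outside the set. -/
theorem norm_ge_of_notMem_shrink {D : Set (X1 d)} (hD : IsOpen D) {R ρ : ℝ}
    (hR : Metric.ball 0 R ⊆ D) (hρ : 0 ≤ ρ) {v : X1 d} (hv : v ∈ (shrink D ρ)ᶜ) :
    R ≤ ‖v‖ + ρ := by
  by_contra hlt
  push Not at hlt
  have hvD : v ∈ D := hR (by
    rw [mem_ball_zero_iff]
    linarith)
  refine hv ⟨hvD, fun hn => ?_⟩
  obtain ⟨w, hw, hvw⟩ := Metric.mem_thickening_iff.1 hn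
  have hwD : w ∉ D := by
    rw [hD.frontier_eq] at hw
    exact hw.2
  refine hwD (hR ?_)
  rw [mem_ball_zero_iff]
  rw [dist_eq_norm] at hvw
  have := norm_sub_norm_le w v
  rw [norm_sub_rev] at this
  linarith

theorem ballM_antitone (lam α₁ : ℝ) (δ : Ioi (0 : ℝ)) (D : Set (X1 d)) :
    Antitone (ballM lam α₁ δ D) := by
  intro ρ ρ' h
  refine le_iInf fun u₀ => le_iInf fun T => le_iInf fun y => le_iInf fun hy => ?_
  refine iInf_le_of_le u₀ (iInf_le_of_le T (iInf_le_of_le y (iInf_le_of_le ?_ le_rfl)))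
  exact ⟨hy.1.trans h, hy.2.1, fun hm => hy.2.2
    ⟨hm.1, fun hn => hm.2 (Metric.thickening_mono h _ hn)⟩⟩

/-- For a small starting ball, independent of `δ`, a path of cost below `1` cannot leave the
shrunk set. -/
theorem exists_one_le_ballM (hα₁ : 2 * |lam| < α₁) {D : Set (X1 d)} (hD : IsOpen D)
    (hD0 : (0 : X1 d) ∈ D) : ∃ ρ : ℝ, 0 < ρ ∧ ∀ δ, 1 ≤ ballM lam α₁ δ D ρ := by
  obtain ⟨R, hR0, hR⟩ := Metric.isOpen_iff.1 hD 0 hD0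
  set B := 2 + d + d * (2 * Real.pi + 4 * Real.pi * (1 / (α₁ - 2 * |lam|) + 2)) ^ 2 with hB
  have hB0 : 0 ≤ B := by positivity
  have hS := Real.sqrt_nonneg B
  refine ⟨R / (Real.sqrt B + 2), by positivity, fun δ => ?_⟩
  set ρ := R / (Real.sqrt B + 2) with hρ
  have hρ0 : 0 < ρ := by positivity
  have hρR : (Real.sqrt B + 2) * ρ = R := mul_div_cancel₀ R (by positivity)
  refine le_iInf fun u₀ => le_iInf fun T => le_iInf fun y => le_iInf fun hy =>
    le_iInf fun g => le_iInf fun h => le_iInf fun hgh => ?_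
  by_contra hlt
  push Not at hlt
  -- the cost is half the energy, so a cost below `1` means an energy below `2`
  have hE : ∫ t in 0..T, |h t| ^ 2 ≤ 2 := by
    rw [ENNReal.ofReal_lt_one] at hlt
    linarith
  have h1 := hgh.2.norm_sq_le hα₁ hgh.1 hy.2.1 hE
  rw [← hB] at h1
  have h2 : ‖y T‖ ≤ Real.sqrt B * ‖u₀‖ := by
    refine le_of_sq_le_sq ?_ (by positivity)
    rwa [mul_pow, Real.sq_sqrt hB0]
  have h3 := norm_ge_of_notMem_shrink hD hR hρ0.le hy.2.2
  have h4 := mul_le_mul_of_nonneg_left hy.1 hS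
  linarith

theorem ballM_le_upperM (δ : Ioi (0 : ℝ)) (D : Set (X1 d)) {ρ : ℝ} (hρ : 0 ≤ ρ) :
    ballM lam α₁ δ D ρ ≤ upperM lam α₁ δ D := by
  refine le_iInf fun T => le_iInf fun y => le_iInf fun hy => ?_
  refine iInf_le_of_le 0 (iInf_le_of_le T (iInf_le_of_le y (iInf_le_of_le ?_ le_rfl)))
  exact ⟨by simpa using hρ, hy.1, fun hm => hy.2 (subset_closure hm.1)⟩

end

end LogSchrodinger

theorem lemma4p1 (d : ℕ) (hd : 1 ≤ d) (lam α₁ : ℝ) (hα₁ : 2 * |lam| < α₁)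
    (D : Set (LogSchrodinger.X1 d)) (hDopen : IsOpen D) (hDbdd : Bornology.IsBounded D)
    (hD0 : (0 : LogSchrodinger.X1 d) ∈ D) :
    0 < (⨅ δ : Set.Ioi (0 : ℝ), LogSchrodinger.lowerM lam α₁ δ D) ∧
      (⨅ δ : Set.Ioi (0 : ℝ), LogSchrodinger.lowerM lam α₁ δ D) ≤
        ⨅ δ : Set.Ioi (0 : ℝ), LogSchrodinger.upperM lam α₁ δ D := by
  refine ⟨?_, iInf_mono fun δ => le_of_tendsto (LogSchrodinger.tendsto_ballM lam α₁ δ D) ?_⟩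
  · obtain ⟨ρ, hρ, hM⟩ := LogSchrodinger.exists_one_le_ballM hα₁ hDopen hD0
    refine one_pos.trans_le (le_iInf fun δ => ge_of_tendsto (LogSchrodinger.tendsto_ballM lam α₁ δ D) ?_)
    filter_upwards [Ioo_mem_nhdsGT hρ] with r hr
    exact (hM δ).trans (LogSchrodinger.ballM_antitone lam α₁ δ D hr.2.le)
  · filter_upwards [self_mem_nhdsWithin] with r hr
    exact LogSchrodinger.ballM_le_upperM δ D (mem_Ioi.1 hr).le
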